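/- Let $K\subset\mathbb R^d$ be non-empty and compact, and write $B(z,r)$ for the closed Euclidean ball. Call $K$ self-embeddable if for all $z\in K$ and $0<r\le\operatorname{diam}K$ there are $a=a(z,r)>0$ and a map $f\colon K\to B(z,r)\cap K$ with $$a\,r|x-y|\le|f(x)-f(y)|\le a^{-1}r|x-y|\qquad(x,y\in K),$$ and uniformly self-embeddable if $a$ can be chosen independently of $z$ and $r$. Let $N_r(A)$ be the least number of closed balls of radius $r$ needed to cover $A$. Let $\dim_H$ and $\mathcal H^s$ denote Hausdorff dimension and Hausdorff measure, and $\overline{\dim}_B K=\limsup_{r\to0^+}\log N_r(K)/\log(1/r)$ the upper box dimension. The Assouad dimension $\dim_A K$ is the infimum of all $s$ for which there is $C>0$ with $N_r(B(x,R)\cap K)\le C(R/r)^s$ for all $0<r\le R<1$ and all $x\in K$. For $x\in K$, the pointwise Assouad dimension $\dim_A(K,x)$ is the infimum of all $s$ for which there are $C>0$ and $\rho>0$ with $N_r(B(x,R)\cap K)\le C(R/r)^s$ for all $0<r\le R<\rho$. Finally, $\operatorname{Tan}(K,x)$ is the set of non-empty compact $F\subset B(0,1)$ such that $F=\lim_{k\to\infty}\bigl(\lambda_k(K-x)\cap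 B(0,1)\bigr)$ in the Hausdorff metric for some positive $\lambda_k\to\infty$. Suppose that $K$ is self-embeddable. Then: (i) $\overline{\dim}_B K\le\dim_A(K,x)$ for every $x\in K$. (ii) There are $x\in K$ and $F\in\operatorname{Tan}(K,x)$ with $\mathcal H^{\dim_A K}(F)>0$ and $\dim_H F=\dim_A(K,x)=\dim_A K$. If $K$ is uniformly self-embeddable, then there is a constant $c>0$ such that the set $$\{x\in K:\ \exists F\in\operatorname{Tan}(K,x)\ \text{with}\ \mathcal H^{\dim_A K}(F)\ge c\}$$ is non-empty and has Hausdorff dimension $\dim_H K$; moreover $\dim_H K=\overline{\dim}_B K$. -/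

import Mathlib

open MeasureTheory Filter Topology
open scoped NNReal ENNReal

noncomputable section

namespace SelfEmbed

/-- `N_r(A)`: the smallest number of closed balls of radius `r` (with centres anywhere in the
ambient space) required to cover `A`. -/
abbrev coverNum {X : Type*} [PseudoEMetricSpace X] (r : ℝ≥0) (A : Set X) : ℕ∞ :=
  Metric.externalCoveringNumber r A

/-- The upper box dimension `limsup_{r → 0+} log N_r(A) / log (1 / r)`. The quotient is computed
in the extended reals and is nonnegative as soon as `r < 1` and `A` is non-empty. -/
def upperBoxDim {X : Type*} [PseudoEMetricSpace X] (A : Set X) : ℝ≥0∞ :=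
  limsup (fun r : ℝ≥0 =>
    (ENNReal.log (coverNum r A : ℝ≥0∞) / ((Real.log (1 / (r : ℝ)) : ℝ) : EReal)).toENNReal)
    (𝓝[>] (0 : ℝ≥0))

/-- The Assouad dimension: the infimum of the exponents `s` for which there is `C > 0` with
`N_r(B(x, R) ∩ K) ≤ C (R / r) ^ s` for all `0 < r ≤ R < 1` and all `x ∈ K`. For non-empty `K` no
negative exponent satisfies this condition, so that `s` may be taken to be nonnegative. -/
def assouadDim {X : Type*} [PseudoMetricSpace X] (K : Set X) : ℝ≥0∞ :=
  ⨅ (s : ℝ≥0) (_ : ∃ C : ℝ≥0, 0 < C ∧ ∀ r R : ℝ≥0, 0 < r → r ≤ R → R < 1 → ∀ x ∈ K,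
    (coverNum r (Metric.closedBall x R ∩ K) : ℝ≥0∞)
      ≤ ((C * (R / r) ^ (s : ℝ) : ℝ≥0) : ℝ≥0∞)), (s : ℝ≥0∞)

/-- The pointwise Assouad dimension of `K` at `x`: the infimum of the exponents `s` for which there
are `C > 0` and `ρ > 0` with `N_r(B(x, R) ∩ K) ≤ C (R / r) ^ s` for all `0 < r ≤ R < ρ`. -/
def pointwiseAssouadDim {X : Type*} [PseudoMetricSpace X] (K : Set X) (x : X) : ℝ≥0∞ :=
  ⨅ (s : ℝ≥0) (_ : ∃ C ρ : ℝ≥0, 0 < C ∧ 0 < ρ ∧ ∀ r R : ℝ≥0, 0 < r → r ≤ R → R < ρ →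
    (coverNum r (Metric.closedBall x R ∩ K) : ℝ≥0∞)
      ≤ ((C * (R / r) ^ (s : ℝ) : ℝ≥0) : ℝ≥0∞)), (s : ℝ≥0∞)

/-- `Tan(K, x)`: the non-empty compact subsets `F` of the closed unit ball that are limits, in the
Hausdorff metric, of `l k • (K - x) ∩ B(0, 1)` for some positive ratios `l k → ∞`. -/
def tangents {E : Type*} [NormedAddCommGroup E] [NormedSpace ℝ E] (K : Set E) (x : E) :
    Set (Set E) :=
  {F | F.Nonempty ∧ IsCompact F ∧ F ⊆ Metric.closedBall 0 1 ∧
    ∃ l : ℕ → ℝ, (∀ k, 0 < l k) ∧ Tendsto l atTop atTop ∧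
      Tendsto (fun k => Metric.hausdorffEDist
        ((fun y => l k • (y - x)) '' K ∩ Metric.closedBall 0 1) F) atTop (𝓝 0)}

/-- There is a map `f : K → B(z, r) ∩ K` with `a r |x - y| ≤ |f x - f y| ≤ a⁻¹ r |x - y|` for all
`x, y ∈ K` (the values of `f` outside `K` play no role). -/
def HasEmbedding {X : Type*} [PseudoMetricSpace X] (K : Set X) (z : X) (r a : ℝ) : Prop :=
  ∃ f : X → X, Set.MapsTo f K (Metric.closedBall z r ∩ K) ∧
    ∀ x ∈ K, ∀ y ∈ K, a * r * dist x y ≤ dist (f x) (f y) ∧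
      dist (f x) (f y) ≤ a⁻¹ * r * dist x y

/-- Self-embeddability: the constant `a` may depend on `z` and `r`. -/
def IsSelfEmbeddable {X : Type*} [PseudoMetricSpace X] (K : Set X) : Prop :=
  ∀ z ∈ K, ∀ r : ℝ, 0 < r → r ≤ Metric.diam K → ∃ a : ℝ, 0 < a ∧ HasEmbedding K z r a

/-- Uniform self-embeddability: one constant `a` serves all `z` and `r`. -/
def IsUniformlySelfEmbeddable {X : Type*} [PseudoMetricSpace X] (K : Set X) : Prop :=
  ∃ a : ℝ, 0 < a ∧ ∀ z ∈ K, ∀ r : ℝ, 0 < r → r ≤ Metric.diam K → HasEmbedding K z r a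

end SelfEmbed

end

/-!
Write `α` for the Assouad dimension of `K`. It is finite, since closed balls of a Euclidean space can
be covered by boundedly many balls of half the radius.

**Content at small scales.** The key notion is a discretised Hausdorff content (`HasContent`): all
finite covers of `K ∩ B(y, R)` by balls of radii at least `ε R` satisfy `∑ ρᵢ ^ α ≥ c R ^ α`. If for
some `ε` this failed at all small balls for a small constant `c`, every ball would have a cover
beating the exponent `α` by a fixed factor. As the radii are bounded below by `ε R`, that cover would
also beat some exponent `s < α`, and iterating the covers (`coverBoundAt_of_refinement`) would give
`dim_A K ≤ s`. The resulting constant `c = 4 ^ (-α)` depends on `α` only, and bi-Lipschitz images of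
`K` have the same Assouad dimension, so that the same constant serves all of them
(`exists_hasContent_image`).

**From content to tangents.** If `K` has content at least `c` around `x` at scales tending to `0` and
resolutions `ε` tending to `0` (`richPoints`), a convergent subsequence of the corresponding blow-ups
has a limit `F` with `μH[α] F ≥ c`, because Hausdorff content is upper semicontinuous
(`exists_tangent_of_hasContent`). Tangents inherit the counting bounds of `K` at `x`, hence
`α ≤ dimH F ≤ dim_A (K, x) ≤ dim_A K = α`.

**Self-embeddable sets.** Inside any ball there is a bi-Lipschitz copy of `K`, and inside that copy a
much smaller ball of content at least `4 ^ (-α)`. A nested sequence of such balls shrinks to a point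
of `richPoints`; the bi-Lipschitz constants are irrelevant, since the bound on the content does not
depend on them. The inequality for the upper box dimension follows from a single copy of `K` in a
small ball around `x`.

**Uniformly self-embeddable sets.** For `s` below the upper box dimension there are arbitrarily
small `σ` for which `K` contains more than `σ ^ (-s)` points that are `σ`-separated. Copying these
points into nested balls gives a tree with a limit set of dimension at least `s`. With uniform
constants, a ball of large content at resolution `1 / (k + 1)` can be found in any ball at the price of
a contraction ratio that depends on `k` only. These extra contractions are inserted at levels so
sparse that they do not affect the dimension (`exists_slow_counter`), and they make all points of the
limit set rich (`le_dimH_richPoints`). The dimension of the limit set is bounded from below by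
mapping it onto `[0, 1]` with base `N` expansions.
-/

namespace SelfEmbed

/-! ### Covering numbers -/

section Covering

variable {X Y : Type*} [PseudoMetricSpace X] [PseudoMetricSpace Y]

lemma coverNum_le_card {A : Set X} {r : ℝ} (S : Finset X)
    (h : A ⊆ ⋃ x ∈ S, Metric.closedBall x r) :
    (coverNum r.toNNReal A : ℝ≥0∞) ≤ S.card := by
  have hc : Metric.IsCover r.toNNReal A (S : Set X) := by
    rw [Metric.isCover_iff_subset_iUnion_closedBall]
    refine h.trans (Set.iUnion₂_mono fun x _ => Metric.closedBall_subset_closedBall ?_)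
    exact Real.le_coe_toNNReal r
  have := hc.externalCoveringNumber_le_encard
  rw [Set.encard_coe_eq_coe_finsetCard] at this
  have h2 : (coverNum r.toNNReal A : ℝ≥0∞) ≤ ((S.card : ℕ∞) : ℝ≥0∞) := ENat.toENNReal_le.2 this
  simpa using h2

lemma exists_finset_coverNum {A : Set X} {r : ℝ} (hr : 0 ≤ r)
    (h : (coverNum r.toNNReal A : ℝ≥0∞) ≠ ⊤) :
    ∃ S : Finset X, A ⊆ (⋃ x ∈ S, Metric.closedBall x r) ∧
      (S.card : ℝ≥0∞) = coverNum r.toNNReal A := by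
  have h1 : coverNum r.toNNReal A ≠ ⊤ := by simpa using h
  obtain ⟨n, hn⟩ := ENat.ne_top_iff_exists.1 h1
  have h2 : coverNum r.toNNReal A < (n + 1 : ℕ) := by
    rw [← hn]; exact_mod_cast Nat.lt_succ_self n
  simp only [coverNum, Metric.externalCoveringNumber, iInf_lt_iff] at h2
  obtain ⟨C, hC, hCn⟩ := h2
  have hfin : C.Finite := Set.encard_lt_top_iff.1 (hCn.trans_le le_top)
  refine ⟨hfin.toFinset, ?_, ?_⟩
  · have := Metric.isCover_iff_subset_iUnion_closedBall.1 hC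
    simpa [Real.coe_toNNReal r hr] using this
  · have h3 := hC.externalCoveringNumber_le_encard
    have h4 : C.encard = coverNum r.toNNReal A := by
      refine le_antisymm ?_ h3
      rw [← hn]
      exact Order.le_of_lt_add_one (by exact_mod_cast hCn)
    rw [← h4, hfin.encard_eq_coe_toFinset_card]
    simp

lemma coverNum_mono {A B : Set X} {r : ℝ≥0} (h : A ⊆ B) :
    (coverNum r A : ℝ≥0∞) ≤ coverNum r B :=
  ENat.toENNReal_le.2 (Metric.externalCoveringNumber_mono_set h)

lemma coverNum_le_one {A : Set X} {x : X} {r : ℝ} (h : A ⊆ Metric.closedBall x r) :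
    (coverNum r.toNNReal A : ℝ≥0∞) ≤ 1 := by
  simpa using coverNum_le_card {x} (by simpa using h)

lemma coverNum_le_sum {ι : Type*} {A : Set X} {r : ℝ} (hr : 0 ≤ r) (I : Finset ι)
    (B : ι → Set X) (h : A ⊆ ⋃ i ∈ I, B i) :
    (coverNum r.toNNReal A : ℝ≥0∞) ≤ ∑ i ∈ I, (coverNum r.toNNReal (B i) : ℝ≥0∞) := by
  classical
  by_cases htop : ∃ i ∈ I, (coverNum r.toNNReal (B i) : ℝ≥0∞) = ⊤
  · obtain ⟨i, hi, h⟩ := htop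
    rw [ENNReal.sum_eq_top.2 ⟨i, hi, h⟩]
    exact le_top
  · push Not at htop
    have : ∀ i, ∃ S : Finset X, i ∈ I → (B i ⊆ ⋃ x ∈ S, Metric.closedBall x r) ∧
        (S.card : ℝ≥0∞) = coverNum r.toNNReal (B i) := fun i => by
      by_cases hi : i ∈ I
      · obtain ⟨S, hS⟩ := exists_finset_coverNum hr (htop i hi)
        exact ⟨S, fun _ => hS⟩
      · exact ⟨∅, fun h => absurd h hi⟩
    choose S hS using this
    refine (coverNum_le_card (I.biUnion S) ?_).trans ?_
    · intro x hx
      obtain ⟨i, hi, hxi⟩ := Set.mem_iUnion₂.1 (h hx)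
      obtain ⟨y, hy, hxy⟩ := Set.mem_iUnion₂.1 ((hS i hi).1 hxi)
      exact Set.mem_iUnion₂.2 ⟨y, Finset.mem_biUnion.2 ⟨i, hi, hy⟩, hxy⟩
    · calc ((I.biUnion S).card : ℝ≥0∞) ≤ ((∑ i ∈ I, (S i).card : ℕ) : ℝ≥0∞) := by
            exact_mod_cast Finset.card_biUnion_le
        _ = ∑ i ∈ I, (coverNum r.toNNReal (B i) : ℝ≥0∞) := by
            push_cast
            exact Finset.sum_congr rfl fun i hi => (hS i hi).2

/-- Covering numbers pull back along maps that contract distances at most by the factor `l`. The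
factor `1 / 2` pays for moving the centres of the balls into the image. -/
lemma coverNum_le_of_expanding {A : Set X} {B : Set Y} {f : X → Y} {l r : ℝ} (hl : 0 < l)
    (hr : 0 ≤ r) (hf : Set.MapsTo f A B) (hd : ∀ x ∈ A, ∀ y ∈ A, l * dist x y ≤ dist (f x) (f y)) :
    (coverNum r.toNNReal A : ℝ≥0∞) ≤ coverNum (l * r / 2).toNNReal B := by
  classical
  by_cases htop : (coverNum (l * r / 2).toNNReal B : ℝ≥0∞) = ⊤
  · rw [htop]; exact le_top
  obtain ⟨S, hS, hcard⟩ := exists_finset_coverNum (by positivity) htop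
  rw [← hcard]
  rcases A.eq_empty_or_nonempty with rfl | ⟨a₀, ha₀⟩
  · simp [coverNum]
  have : ∀ y, ∃ x ∈ A, ∀ z ∈ A, dist (f z) y ≤ l * r / 2 → dist z x ≤ r := by
    intro y
    by_cases h : ∃ x ∈ A, dist (f x) y ≤ l * r / 2
    · obtain ⟨x, hx, hxy⟩ := h
      refine ⟨x, hx, fun z hz hzy => ?_⟩
      have h1 := hd z hz x hx
      have h2 := dist_triangle_right (f z) (f x) y
      exact le_of_mul_le_mul_left (by linarith : l * dist z x ≤ l * r) hl
    · exact ⟨a₀, ha₀, fun z hz hzy => absurd ⟨z, hz, hzy⟩ h⟩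
  choose g hg hg' using this
  refine (coverNum_le_card (S.image g) ?_).trans (by exact_mod_cast Finset.card_image_le)
  intro z hz
  obtain ⟨y, hy, hzy⟩ := Set.mem_iUnion₂.1 (hS (hf hz))
  exact Set.mem_iUnion₂.2 ⟨g y, Finset.mem_image_of_mem g hy, hg' y z hz hzy⟩

lemma coverNum_ne_top {A : Set X} (hA : IsCompact A) {r : ℝ} (hr : 0 < r) :
    (coverNum r.toNNReal A : ℝ≥0∞) ≠ ⊤ := by
  obtain ⟨N, -, hN, hc⟩ := Metric.exists_finite_isCover_of_isCompact
    (ε := r.toNNReal) (by simpa using hr) hA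
  have h1 := hc.externalCoveringNumber_le_encard
  have h2 : coverNum r.toNNReal A ≠ ⊤ := ne_top_of_le_ne_top (Set.encard_ne_top_iff.2 hN) h1
  simpa using h2

/-- The local counting bound at `x` that enters the definitions of the Assouad dimensions, with
real parameters. -/
def CoverBoundAt (A : Set X) (x : X) (s C R₀ : ℝ) : Prop :=
  ∀ r R : ℝ, 0 < r → r ≤ R → R < R₀ →
    (coverNum r.toNNReal (Metric.closedBall x R ∩ A) : ℝ≥0∞) ≤ ENNReal.ofReal (C * (R / r) ^ s)

lemma ofReal_bound_eq (C r R : ℝ≥0) (s : ℝ) :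
    ENNReal.ofReal (C * (R / r : ℝ) ^ s) = ((C * (R / r) ^ s : ℝ≥0) : ℝ≥0∞) := by
  rw [← ENNReal.ofReal_coe_nnreal]
  push_cast
  rfl

lemma coverBoundAt_nnreal {A : Set X} {x : X} {s : ℝ} {C R₀ : ℝ≥0}
    (h : CoverBoundAt A x s C R₀) (r R : ℝ≥0) (hr : 0 < r) (hrR : r ≤ R) (hR : R < R₀) :
    (coverNum r (Metric.closedBall x R ∩ A) : ℝ≥0∞) ≤ ((C * (R / r) ^ s : ℝ≥0) : ℝ≥0∞) := by
  have := h r R (by exact_mod_cast hr) (by exact_mod_cast hrR) (by exact_mod_cast hR)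
  rwa [Real.toNNReal_coe, ofReal_bound_eq] at this

lemma coverBoundAt_of_nnreal {A : Set X} {x : X} {s : ℝ} {C R₀ : ℝ≥0}
    (h : ∀ r R : ℝ≥0, 0 < r → r ≤ R → R < R₀ →
      (coverNum r (Metric.closedBall x R ∩ A) : ℝ≥0∞) ≤ ((C * (R / r) ^ s : ℝ≥0) : ℝ≥0∞)) :
    CoverBoundAt A x s C R₀ := by
  intro r R hr hrR hR
  lift r to ℝ≥0 using hr.le
  lift R to ℝ≥0 using r.2.trans hrR
  rw [Real.toNNReal_coe, ofReal_bound_eq]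
  exact h r R (by exact_mod_cast hr) (by exact_mod_cast hrR) (by exact_mod_cast hR)

lemma pointwiseAssouadDim_le_assouadDim {A : Set X} {x : X} (hx : x ∈ A) :
    pointwiseAssouadDim A x ≤ assouadDim A := by
  refine le_iInf₂ fun s ⟨C, hC, h⟩ => iInf₂_le s ⟨C, 1, hC, one_pos, fun r R hr hrR hR => ?_⟩
  exact h r R hr hrR hR x hx

lemma exists_coverBoundAt_of_pointwiseAssouadDim_lt {A : Set X} {x : X} {t : ℝ≥0∞}
    (h : pointwiseAssouadDim A x < t) : ∃ s : ℝ≥0, (s : ℝ≥0∞) < t ∧ ∃ C > 0, ∃ R₀ > 0,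
      CoverBoundAt A x s C R₀ := by
  simp only [pointwiseAssouadDim, iInf_lt_iff] at h
  obtain ⟨s, ⟨C, ρ, hC, hρ, h⟩, hs⟩ := h
  exact ⟨s, hs, C, by exact_mod_cast hC, ρ, by exact_mod_cast hρ, coverBoundAt_of_nnreal h⟩

/-- For a compact set, a uniform counting bound at small scales bounds the Assouad dimension: the
larger scales only cost a multiplicative constant. -/
lemma assouadDim_le_of_coverBound {A : Set X} (hA : IsCompact A) (s : ℝ≥0) {C R₀ : ℝ}
    (hR₀ : 0 < R₀) (h : ∀ x ∈ A, CoverBoundAt A x s C R₀) : assouadDim A ≤ s := by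
  set ρ := R₀ / 4 with hρ
  have hρ0 : 0 < ρ := by positivity
  obtain ⟨S, hS, -⟩ := exists_finset_coverNum hρ0.le (coverNum_ne_top hA hρ0)
  have hc1 : C ≤ max 1 C := le_max_right _ _
  have hc2 : (1 : ℝ) ≤ max 1 C := le_max_left _ _
  have hc0 : (0 : ℝ) ≤ max 1 C := zero_le_one.trans hc2
  have key : ∀ x ∈ A, CoverBoundAt A x s (max 1 C * (1 + S.card)) 1 := by
    intro x hx r R hr hrR hR1
    have hR : 0 < R := hr.trans_le hrR
    have hq : 1 ≤ (R / r) ^ (s : ℝ) :=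
      Real.one_le_rpow ((one_le_div hr).2 hrR) s.2
    by_cases hRR : R < R₀
    · refine (h x hx r R hr hrR hRR).trans (ENNReal.ofReal_le_ofReal ?_)
      gcongr
      refine hc1.trans (le_mul_of_one_le_right hc0 ?_)
      simp
    · push Not at hRR
      have hcell : ∀ y ∈ S, (coverNum r.toNNReal (Metric.closedBall y ρ ∩ A) : ℝ≥0∞) ≤
          ENNReal.ofReal (max 1 C * (R / r) ^ (s : ℝ)) := by
        intro y hy
        rcases (Metric.closedBall y ρ ∩ A).eq_empty_or_nonempty with he | ⟨a, hay, haA⟩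
        · simp [he, coverNum]
        have hsub : Metric.closedBall y ρ ⊆ Metric.closedBall a (2 * ρ) := by
          refine Metric.closedBall_subset_closedBall' ?_
          rw [Metric.mem_closedBall, dist_comm] at hay
          linarith
        by_cases hr2 : r ≤ 2 * ρ
        · refine (coverNum_mono (Set.inter_subset_inter_left A hsub)).trans
            ((h a haA r (2 * ρ) hr hr2 (by linarith)).trans (ENNReal.ofReal_le_ofReal ?_))
          gcongr
          linarith
        · refine (coverNum_le_one (x := a) (Set.inter_subset_left.trans (hsub.trans
            (Metric.closedBall_subset_closedBall (by linarith))))).trans ?_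
          rw [ENNReal.one_le_ofReal]
          exact one_le_mul_of_one_le_of_one_le hc2 hq
      refine (coverNum_le_sum hr.le S (fun y => Metric.closedBall y ρ ∩ A) ?_).trans
        ((Finset.sum_le_sum hcell).trans ?_)
      · rintro z ⟨-, hz⟩
        obtain ⟨y, hy, hzy⟩ := Set.mem_iUnion₂.1 (hS hz)
        exact Set.mem_iUnion₂.2 ⟨y, hy, hzy, hz⟩
      · rw [Finset.sum_const, nsmul_eq_mul, ← ENNReal.ofReal_natCast,
          ← ENNReal.ofReal_mul (by positivity)]
        refine ENNReal.ofReal_le_ofReal ?_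
        have : 0 ≤ max 1 C * (R / r) ^ (s : ℝ) := by positivity
        nlinarith
  have hC' : (0 : ℝ) < max 1 C * (1 + S.card) := by positivity
  refine iInf₂_le s ⟨(max 1 C * (1 + S.card)).toNNReal, by simpa using hC',
    fun r R hr hrR hR x hx => coverBoundAt_nnreal (R₀ := 1) ?_ r R hr hrR hR⟩
  rw [Real.coe_toNNReal _ hC'.le]
  exact_mod_cast key x hx

/-- Self-improvement of covers: if every ball of `A` has a cover by smaller balls, of relative radii
in `[ε, 1 / 2]`, whose `s`-th powers of the radii do not add up to more than that of the original
ball, then iterating the covers gives counting bounds with exponent `s`. -/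
lemma coverBoundAt_of_refinement {A : Set X} {s ε R₀ : ℝ} (hs : 0 ≤ s) (hε : 0 < ε)
    (H : ∀ y ∈ A, ∀ R, 0 < R → R < R₀ → ∃ (ι : Type) (I : Finset ι) (z : ι → X) (ρ : ι → ℝ),
      (∀ i ∈ I, z i ∈ A) ∧ (∀ i ∈ I, ε * R ≤ ρ i) ∧ (∀ i ∈ I, ρ i ≤ R / 2) ∧
      (Metric.closedBall y R ∩ A ⊆ ⋃ i ∈ I, Metric.closedBall (z i) (ρ i)) ∧
      ∑ i ∈ I, ρ i ^ s ≤ R ^ s) {x : X} (hx : x ∈ A) (hε1 : ε ≤ 1) :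
    CoverBoundAt A x s (ε ^ (-s)) R₀ := by
  have key : ∀ r : ℝ, 0 < r → ∀ n : ℕ, ∀ R, ε * r ≤ R → R ≤ 2 ^ n * r → R < R₀ → ∀ y ∈ A,
      (coverNum r.toNNReal (Metric.closedBall y R ∩ A) : ℝ≥0∞) ≤
        ENNReal.ofReal (ε ^ (-s) * (R / r) ^ s) := by
    intro r hr n
    have base : ∀ R, ε * r ≤ R → R ≤ r → ∀ y ∈ A,
      (coverNum r.toNNReal (Metric.closedBall y R ∩ A) : ℝ≥0∞) ≤
        ENNReal.ofReal (ε ^ (-s) * (R / r) ^ s) := by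
      intro R h1 h2 y hy
      refine (coverNum_le_one (x := y) (Set.inter_subset_left.trans
        (Metric.closedBall_subset_closedBall h2))).trans ?_
      rw [ENNReal.one_le_ofReal, Real.rpow_neg hε.le, inv_mul_eq_div, one_le_div (by positivity)]
      gcongr
      rwa [le_div_iff₀ hr]
    induction n with
    | zero => intro R h1 h2 _ y hy; exact base R h1 (by simpa using h2) y hy
    | succ n ih =>
      intro R h1 h2 hR y hy
      by_cases hRr : R ≤ r
      · exact base R h1 hRr y hy
      push Not at hRr
      have hR0 : 0 < R := hr.trans hRr
      obtain ⟨ι, I, z, ρ, hzA, hρ1, hρ2, hcov, hsum⟩ := H y hy R hR0 hR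
      have hρ0 : ∀ i ∈ I, 0 < ρ i := fun i hi => lt_of_lt_of_le (by positivity) (hρ1 i hi)
      have hcell : ∀ i ∈ I,
          (coverNum r.toNNReal (Metric.closedBall (z i) (ρ i) ∩ A) : ℝ≥0∞) ≤
            ENNReal.ofReal (ε ^ (-s) * (ρ i / r) ^ s) := fun i hi => by
        refine ih (ρ i) ?_ ?_ ?_ (z i) (hzA i hi)
        · exact le_trans (by gcongr) (hρ1 i hi)
        · have := hρ2 i hi
          rw [pow_succ] at h2
          linarith
        · have := hρ2 i hi
          linarith
      refine (coverNum_le_sum hr.le I (fun i => Metric.closedBall (z i) (ρ i) ∩ A) ?_).trans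
        ((Finset.sum_le_sum hcell).trans ?_)
      · intro w hw
        obtain ⟨i, hi, hwi⟩ := Set.mem_iUnion₂.1 (hcov hw)
        exact Set.mem_iUnion₂.2 ⟨i, hi, hwi, hw.2⟩
      · rw [← ENNReal.ofReal_sum_of_nonneg
          (fun i hi => by have := hρ0 i hi; positivity), ← Finset.mul_sum]
        refine ENNReal.ofReal_le_ofReal ?_
        gcongr
        calc ∑ i ∈ I, (ρ i / r) ^ s = (∑ i ∈ I, ρ i ^ s) / r ^ s := by
              rw [Finset.sum_div]
              exact Finset.sum_congr rfl fun i hi => Real.div_rpow (hρ0 i hi).le hr.le s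
          _ ≤ R ^ s / r ^ s := by gcongr
          _ = (R / r) ^ s := (Real.div_rpow hR0.le hr.le s).symm
  intro r R hr hrR hR
  obtain ⟨n, hn⟩ := pow_unbounded_of_one_lt (R / r) (one_lt_two : (1 : ℝ) < 2)
  refine key r hr n R ?_ ((div_lt_iff₀ hr).1 hn).le hR x hx
  nlinarith

end Covering

/-- The Assouad dimension of a compact subset of a finite-dimensional space is finite, because
closed balls can be covered by a fixed number of balls of half the radius. -/
lemma assouadDim_ne_top {E : Type} [NormedAddCommGroup E] [NormedSpace ℝ E] [ProperSpace E]
    {A : Set E} (hA : IsCompact A) : assouadDim A ≠ ⊤ := by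
  obtain ⟨S, hS, -⟩ := exists_finset_coverNum (A := Metric.closedBall (0 : E) 1) (r := 1 / 4)
    (by norm_num) (coverNum_ne_top (isCompact_closedBall _ _) (by norm_num))
  obtain ⟨n, hn⟩ := pow_unbounded_of_one_lt (S.card : ℝ) (one_lt_two : (1 : ℝ) < 2)
  classical
  refine ne_top_of_le_ne_top (ENNReal.coe_ne_top (r := (n : ℝ≥0)))
    (assouadDim_le_of_coverBound hA n (R₀ := 1) one_pos fun x hx =>
      coverBoundAt_of_refinement (ε := 1 / 2) (by simp) (by norm_num) ?_ hx (by norm_num))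
  intro y hy R hR _
  let P : E → Prop := fun v => ∃ a ∈ A, dist a (y + R • v) ≤ R / 4
  have hex : ∀ v, ∃ a, P v → a ∈ A ∧ dist a (y + R • v) ≤ R / 4 := fun v => by
    by_cases h : P v
    · obtain ⟨a, ha⟩ := h; exact ⟨a, fun _ => ha⟩
    · exact ⟨0, fun h' => absurd h' h⟩
  choose g hg using hex
  refine ⟨E, S.filter P, g, fun _ => R / 2, ?_, ?_, ?_, ?_, ?_⟩
  · exact fun v hv => (hg v (Finset.mem_filter.1 hv).2).1
  · intro v _; linarith
  · intro v _; exact le_rfl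
  · rintro w ⟨hw, hwA⟩
    have hw' : R⁻¹ • (w - y) ∈ Metric.closedBall (0 : E) 1 := by
      rw [mem_closedBall_zero_iff, norm_smul, norm_inv, Real.norm_of_nonneg hR.le,
        inv_mul_le_iff₀ hR, mul_one, ← dist_eq_norm]
      exact hw
    obtain ⟨v, hv, hwv⟩ := Set.mem_iUnion₂.1 (hS hw')
    have hd : dist w (y + R • v) ≤ R / 4 := by
      have h1 : w - (y + R • v) = R • (R⁻¹ • (w - y) - v) := by
        rw [smul_sub, smul_inv_smul₀ hR.ne']; abel
      rw [dist_eq_norm, h1, norm_smul, Real.norm_of_nonneg hR.le, ← dist_eq_norm]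
      have := Metric.mem_closedBall.1 hwv
      nlinarith
    have hP : P v := ⟨w, hwA, hd⟩
    refine Set.mem_iUnion₂.2 ⟨v, Finset.mem_filter.2 ⟨hv, hP⟩, ?_⟩
    rw [Metric.mem_closedBall]
    have := dist_triangle_right w (g v) (y + R • v)
    linarith [(hg v hP).2]
  · have h1 : ((S.filter P).card : ℝ) ≤ S.card := by exact_mod_cast Finset.card_filter_le _ _
    simp only [NNReal.coe_natCast, Real.rpow_natCast, Finset.sum_const, nsmul_eq_mul, div_pow]
    rw [mul_div_assoc', div_le_iff₀ (by positivity), mul_comm]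
    gcongr
    exact h1.trans hn.le

/-! ### Discretised Hausdorff content -/

section Content

variable {X Y : Type*} [PseudoMetricSpace X] [PseudoMetricSpace Y]

/-- The `α`-dimensional Hausdorff content of `A`, computed with finitely many closed balls of radii
at least `ε * R`, is at least `c * R ^ α`. Here `R` is the scale at which `A` is looked at and `ε`
the relative resolution. Restricting the index types to `Type` is harmless, as only their finite
subsets matter. -/
def HasContent (A : Set X) (R ε c α : ℝ) : Prop :=
  ∀ (ι : Type) (I : Finset ι) (z : ι → X) (ρ : ι → ℝ), (∀ i ∈ I, ε * R ≤ ρ i) →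
    A ⊆ (⋃ i ∈ I, Metric.closedBall (z i) (ρ i)) → c * R ^ α ≤ ∑ i ∈ I, ρ i ^ α

lemma HasContent.mono_set {A B : Set X} {R ε c α : ℝ} (h : HasContent A R ε c α) (hAB : A ⊆ B) :
    HasContent B R ε c α := fun ι I z ρ h1 h2 => h ι I z ρ h1 (hAB.trans h2)

lemma HasContent.mono_resolution {A : Set X} {R ε ε' c α : ℝ} (h : HasContent A R ε c α)
    (hR : 0 ≤ R) (hε : ε ≤ ε') : HasContent A R ε' c α := fun ι I z ρ h1 h2 =>
  h ι I z ρ (fun i hi => (mul_le_mul_of_nonneg_right hε hR).trans (h1 i hi)) h2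

lemma HasContent.mono_const {A : Set X} {R ε c c' α : ℝ} (h : HasContent A R ε c α)
    (hR : 0 ≤ R) (hc : c' ≤ c) : HasContent A R ε c' α := fun ι I z ρ h1 h2 =>
  (mul_le_mul_of_nonneg_right hc (Real.rpow_nonneg hR _)).trans (h ι I z ρ h1 h2)

lemma HasContent.double {A : Set X} {R ε c α : ℝ} (h : HasContent A R ε c α)
    (hR : 0 ≤ R) (hε : 0 ≤ ε) : HasContent A (2 * R) ε (c * 2 ^ (-α)) α := fun ι I z ρ h1 h2 => by
  refine le_trans (le_of_eq ?_) (h ι I z ρ (fun i hi => le_trans ?_ (h1 i hi)) h2)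
  · rw [Real.mul_rpow two_pos.le hR, Real.rpow_neg two_pos.le]
    field_simp
  · nlinarith [mul_nonneg hε hR]

lemma hasContent_zero {A : Set X} (hA : A.Nonempty) {R ε c : ℝ} (hc : c ≤ 1) :
    HasContent A R ε c 0 := fun ι I z ρ _ h => by
  obtain ⟨a, ha⟩ := hA
  obtain ⟨i, hi, -⟩ := Set.mem_iUnion₂.1 (h ha)
  have : 0 < I.card := Finset.card_pos.2 ⟨i, hi⟩
  simp only [Real.rpow_zero, mul_one, Finset.sum_const, nsmul_eq_mul]
  exact hc.trans (by exact_mod_cast this)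

/-- Content is transported by maps that are bi-Lipschitz at scale `r`. The distortion `a` enters
twice: once because the image lives at scale `a⁻¹ * r * R`, and once through the lower bound. -/
lemma HasContent.image [Nonempty X] {A K : Set X} {R ε c α a r : ℝ} {f : X → Y}
    (h : HasContent A R ε c α) (hAK : A ⊆ K) (hε : 0 < ε) (hR : 0 < R) (ha : 0 < a) (ha1 : a ≤ 1)
    (hr : 0 < r)
    (hf : ∀ x ∈ K, ∀ y ∈ K, a * r * dist x y ≤ dist (f x) (f y)) :
    HasContent (f '' A) (a⁻¹ * r * R) ε (c * (a ^ 2 / 2) ^ α) α := by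
  intro ι I z ρ h1 h2
  have hρ : ∀ i ∈ I, 0 < ρ i := fun i hi => lt_of_lt_of_le (by positivity) (h1 i hi)
  have hex : ∀ i, ∃ w, i ∈ I → ∀ x ∈ A, f x ∈ Metric.closedBall (z i) (ρ i) →
      x ∈ Metric.closedBall w (2 * ρ i / (a * r)) := by
    intro i
    by_cases hi : ∃ w ∈ A, f w ∈ Metric.closedBall (z i) (ρ i)
    · obtain ⟨w, hwA, hw⟩ := hi
      refine ⟨w, fun _ x hx hfx => ?_⟩
      rw [Metric.mem_closedBall, le_div_iff₀ (by positivity)]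
      have h3 := hf x (hAK hx) w (hAK hwA)
      have h4 := dist_triangle_right (f x) (f w) (z i)
      rw [Metric.mem_closedBall] at hw hfx
      linarith
    · exact ⟨Classical.arbitrary X, fun _ x hx hfx => absurd ⟨x, hx, hfx⟩ hi⟩
  choose w hw using hex
  have h3 := h ι I w (fun i => 2 * ρ i / (a * r)) ?_ ?_
  · have h4 : ∑ i ∈ I, (2 * ρ i / (a * r)) ^ α = (2 / (a * r)) ^ α * ∑ i ∈ I, ρ i ^ α := by
      rw [Finset.mul_sum]
      refine Finset.sum_congr rfl fun i hi => ?_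
      rw [← Real.mul_rpow (by positivity) (hρ i hi).le]
      congr 1; ring
    rw [h4] at h3
    have h5 : (a ^ 2 / 2) ^ α * (a⁻¹ * r * R) ^ α = R ^ α * (a * r / 2) ^ α := by
      rw [← Real.mul_rpow (by positivity) (by positivity),
        ← Real.mul_rpow (by positivity) (by positivity)]
      congr 1; field_simp
    have h6 : (a * r / 2) ^ α * (2 / (a * r)) ^ α = 1 := by
      rw [← Real.mul_rpow (by positivity) (by positivity)]
      rw [show a * r / 2 * (2 / (a * r)) = 1 by field_simp, Real.one_rpow]
    calc c * (a ^ 2 / 2) ^ α * (a⁻¹ * r * R) ^ α = (a * r / 2) ^ α * (c * R ^ α) := by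
          rw [mul_assoc, h5]; ring
      _ ≤ (a * r / 2) ^ α * ((2 / (a * r)) ^ α * ∑ i ∈ I, ρ i ^ α) := by gcongr
      _ = ∑ i ∈ I, ρ i ^ α := by rw [← mul_assoc, h6, one_mul]
  · intro i hi
    rw [le_div_iff₀ (by positivity)]
    have h5 := h1 i hi
    have h6 : ε * R * (a * r) ≤ ε * (a⁻¹ * r * R) := by
      have : a ≤ a⁻¹ := ha1.trans ((one_le_inv₀ ha).2 ha1)
      have h7 : 0 ≤ ε * r * R := by positivity
      nlinarith
    linarith [hρ i hi]
  · intro x hx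
    obtain ⟨i, hi, hxi⟩ := Set.mem_iUnion₂.1 (h2 (Set.mem_image_of_mem f hx))
    exact Set.mem_iUnion₂.2 ⟨i, hi, hw i hi x hx hxi⟩

/-- A bi-Lipschitz image of a compact set of Assouad dimension `α` contains, at every resolution,
arbitrarily small balls of large `α`-dimensional content. The constant `4 ^ (-α)` does not depend on
the bi-Lipschitz constants. Otherwise all small balls would have covers that beat the exponent `α`
by a fixed factor, hence also a slightly smaller exponent, and `coverBoundAt_of_refinement` would
make the Assouad dimension smaller than `α`. -/
lemma exists_hasContent_image {K : Set X} (hK : IsCompact K) (hne : K.Nonempty) {α : ℝ≥0}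
    (hα : assouadDim K = α) {f : X → Y} {l L : ℝ} (hl : 0 < l)
    (hf : ∀ x ∈ K, ∀ y ∈ K, l * dist x y ≤ dist (f x) (f y) ∧ dist (f x) (f y) ≤ L * dist x y)
    {ε R₀ : ℝ} (hε : 0 < ε) (hR₀ : 0 < R₀) :
    ∃ y ∈ f '' K, ∃ R, 0 < R ∧ R < R₀ ∧
      HasContent (Metric.closedBall y R ∩ f '' K) R ε (4 ^ (-α : ℝ)) α := by
  rcases eq_or_ne α 0 with rfl | hα0
  · obtain ⟨x, hx⟩ := hne
    refine ⟨f x, Set.mem_image_of_mem f hx, R₀ / 2, by positivity, by linarith, ?_⟩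
    have hne' : (Metric.closedBall (f x) (R₀ / 2) ∩ f '' K).Nonempty :=
      ⟨f x, Metric.mem_closedBall_self (by positivity), Set.mem_image_of_mem f hx⟩
    rw [NNReal.coe_zero]
    exact hasContent_zero hne' (by simp)
  have hα0' : (0 : ℝ) < α := by exact_mod_cast pos_iff_ne_zero.2 hα0
  by_contra hcon
  push Not at hcon
  set e : ℝ := min ε (1 / 2) with he
  have he0 : 0 < e := by positivity
  have he1 : 2 * e ≤ 1 := by have : e ≤ 1 / 2 := min_le_right _ _; linarith
  -- the loss from lowering the exponent by `δ` is absorbed by the factor `2 ^ α`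
  obtain ⟨δ, hδ, hδ0, hδα⟩ : ∃ δ : ℝ, (2 * e) ^ (-δ) < 2 ^ (α : ℝ) ∧ 0 < δ ∧ δ < α := by
    have h1 : Tendsto (fun δ : ℝ => (2 * e) ^ (-δ)) (𝓝 0) (𝓝 ((2 * e) ^ (-(0 : ℝ)))) := by
      have : Continuous fun δ : ℝ => (2 * e) ^ (-δ) :=
        (Real.continuous_const_rpow (by positivity)).comp continuous_neg
      exact this.tendsto 0
    have h2 : (2 * e) ^ (-(0 : ℝ)) < 2 ^ (α : ℝ) := by
      rw [neg_zero, Real.rpow_zero]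
      exact Real.one_lt_rpow one_lt_two hα0'
    have h3 : ∀ᶠ δ : ℝ in 𝓝[>] 0, (2 * e) ^ (-δ) < 2 ^ (α : ℝ) :=
      (h1.mono_left nhdsWithin_le_nhds).eventually (gt_mem_nhds h2)
    have h4 : ∀ᶠ δ : ℝ in 𝓝[>] 0, δ ∈ Set.Ioo 0 (α : ℝ) := Ioo_mem_nhdsGT hα0'
    obtain ⟨δ, h4, h5⟩ := (h3.and h4).exists
    exact ⟨δ, h4, h5.1, h5.2⟩
  have hs : (0 : ℝ) ≤ α - δ := by linarith
  have hB : ∀ y ∈ f '' K, CoverBoundAt (f '' K) y (α - δ) ((2 * e) ^ (-(α - δ))) R₀ := by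
    intro y hy
    refine coverBoundAt_of_refinement hs (by positivity) ?_ hy he1
    intro y hy R hR hRR
    have hnot : ¬ HasContent (Metric.closedBall y R ∩ f '' K) R e (4 ^ (-α : ℝ)) α := fun h =>
      hcon y hy R hR hRR (h.mono_resolution hR.le (min_le_left _ _))
    simp only [HasContent, not_forall, not_le] at hnot
    obtain ⟨ι, I, z, ρ, hρ, hcov, hsum⟩ := hnot
    have hρ0 : ∀ i ∈ I, 0 < ρ i := fun i hi => lt_of_lt_of_le (by positivity) (hρ i hi)
    have hex : ∀ i, ∃ w ∈ f '' K, ∀ x ∈ f '' K, x ∈ Metric.closedBall (z i) (ρ i) →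
        x ∈ Metric.closedBall w (2 * ρ i) := by
      intro i
      by_cases hi : ∃ w ∈ f '' K, w ∈ Metric.closedBall (z i) (ρ i)
      · obtain ⟨w, hw, hwi⟩ := hi
        refine ⟨w, hw, fun x hx hxi => ?_⟩
        rw [Metric.mem_closedBall] at *
        linarith [dist_triangle_right x w (z i)]
      · exact ⟨y, hy, fun x hx hxi => absurd ⟨x, hx, hxi⟩ hi⟩
    choose w hwK hw using hex
    have hsum2 : ∑ i ∈ I, (2 * ρ i) ^ (α : ℝ) < 2 ^ (-α : ℝ) * R ^ (α : ℝ) := by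
      have h1 : ∑ i ∈ I, (2 * ρ i) ^ (α : ℝ) = 2 ^ (α : ℝ) * ∑ i ∈ I, ρ i ^ (α : ℝ) := by
        rw [Finset.mul_sum]
        exact Finset.sum_congr rfl fun i hi => Real.mul_rpow two_pos.le (hρ0 i hi).le
      have h2 : (2 : ℝ) ^ (-α : ℝ) = 2 ^ (α : ℝ) * 4 ^ (-α : ℝ) := by
        rw [show (4 : ℝ) = 2 * 2 by norm_num, Real.mul_rpow two_pos.le two_pos.le, ← mul_assoc,
          ← Real.rpow_add two_pos, add_neg_cancel, Real.rpow_zero, one_mul]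
      rw [h1, h2, mul_assoc]
      gcongr
    have hle : ∀ i ∈ I, 2 * ρ i ≤ R / 2 := by
      intro i hi
      have h0 := hρ0 i hi
      have h1 : (2 * ρ i) ^ (α : ℝ) < (R / 2) ^ (α : ℝ) := by
        calc (2 * ρ i) ^ (α : ℝ) ≤ ∑ i ∈ I, (2 * ρ i) ^ (α : ℝ) :=
              Finset.single_le_sum (f := fun i => (2 * ρ i) ^ (α : ℝ))
                (fun j hj => by have := hρ0 j hj; positivity) hi
          _ < 2 ^ (-α : ℝ) * R ^ (α : ℝ) := hsum2
          _ = (R / 2) ^ (α : ℝ) := by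
              rw [Real.div_rpow hR.le two_pos.le, Real.rpow_neg two_pos.le]
              ring
      exact ((Real.rpow_lt_rpow_iff (by positivity) (by positivity) hα0').1 h1).le
    refine ⟨ι, I, w, fun i => 2 * ρ i, fun i _ => hwK i, ?_, hle, ?_, ?_⟩
    · intro i hi
      have := hρ i hi
      linarith
    · intro x hx
      obtain ⟨i, hi, hxi⟩ := Set.mem_iUnion₂.1 (hcov hx)
      exact Set.mem_iUnion₂.2 ⟨i, hi, hw i x hx.2 hxi⟩
    · have h1 : ∀ i ∈ I, (2 * ρ i) ^ (α - δ : ℝ) ≤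
          (2 * ρ i) ^ (α : ℝ) * (2 * e * R) ^ (-δ) := by
        intro i hi
        have h0 := hρ0 i hi
        rw [sub_eq_add_neg, Real.rpow_add (by positivity)]
        refine mul_le_mul_of_nonneg_left ?_ (by positivity)
        refine Real.rpow_le_rpow_of_nonpos (by positivity) ?_ (by linarith)
        have := hρ i hi
        linarith
      calc ∑ i ∈ I, (2 * ρ i) ^ (α - δ : ℝ)
          ≤ ∑ i ∈ I, (2 * ρ i) ^ (α : ℝ) * (2 * e * R) ^ (-δ) := Finset.sum_le_sum h1
        _ = (∑ i ∈ I, (2 * ρ i) ^ (α : ℝ)) * (2 * e * R) ^ (-δ) := by rw [Finset.sum_mul]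
        _ ≤ (2 ^ (-α : ℝ) * R ^ (α : ℝ)) * ((2 * e) ^ (-δ) * R ^ (-δ)) := by
            rw [Real.mul_rpow (by positivity) hR.le]
            gcongr
        _ ≤ (2 ^ (-α : ℝ) * R ^ (α : ℝ)) * (2 ^ (α : ℝ) * R ^ (-δ)) := by gcongr
        _ = R ^ (α - δ : ℝ) := by
            rw [sub_eq_add_neg, Real.rpow_add hR, Real.rpow_neg two_pos.le]
            field_simp
  have hL : 0 < max l L := hl.trans_le (le_max_left _ _)
  have hs' : ((α - δ : ℝ).toNNReal : ℝ) = α - δ := Real.coe_toNNReal _ hs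
  have hdim : assouadDim K ≤ ((α - δ : ℝ).toNNReal : ℝ≥0∞) := by
    refine assouadDim_le_of_coverBound hK _ (R₀ := R₀ / max l L)
      (C := (2 * e) ^ (-(α - δ : ℝ)) * (2 * max l L / l) ^ (α - δ : ℝ)) (by positivity) ?_
    intro x hx r R hr hrR hR
    have hR0 : 0 < R := hr.trans_le hrR
    rw [lt_div_iff₀ hL] at hR
    have h1 := coverNum_le_of_expanding (A := Metric.closedBall x R ∩ K)
      (B := Metric.closedBall (f x) (max l L * R) ∩ f '' K) (f := f) hl hr.le ?_
      (fun u hu v hv => (hf u hu.2 v hv.2).1)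
    · refine h1.trans ((hB (f x) (Set.mem_image_of_mem f hx) (l * r / 2) (max l L * R)
        (by positivity) ?_ (by linarith)).trans (ENNReal.ofReal_le_ofReal (le_of_eq ?_)))
      · have : l ≤ max l L := le_max_left _ _
        nlinarith [mul_le_mul this hrR hr.le hL.le, mul_pos hl hr]
      · rw [mul_assoc, hs', ← Real.mul_rpow (by positivity) (by positivity)]
        congr 2
        field_simp
    · rintro u ⟨hu, huK⟩
      refine ⟨?_, Set.mem_image_of_mem f huK⟩
      rw [Metric.mem_closedBall] at *
      calc dist (f u) (f x) ≤ L * dist u x := (hf u huK x hx).2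
        _ ≤ max l L * R := by gcongr; exact le_max_right _ _
  rw [hα, ENNReal.coe_le_coe, ← NNReal.coe_le_coe, hs'] at hdim
  linarith

end Content

/-! ### Hausdorff dimension and covering numbers -/

/-- Counting bounds with exponent `s` at all small scales bound the Hausdorff dimension by `s`. -/
lemma dimH_le_of_coverNum_le {X : Type*} [MetricSpace X] {A : Set X} (s : ℝ≥0) (C : ℝ)
    (h : ∀ᶠ r : ℝ in 𝓝[>] 0, (coverNum r.toNNReal A : ℝ≥0∞) ≤ ENNReal.ofReal (C * r ^ (-(s : ℝ)))) :
    dimH A ≤ s := by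
  borelize X
  have hex : ∀ r : ℝ, ∃ S : Finset X, 0 < r →
      (coverNum r.toNNReal A : ℝ≥0∞) ≤ ENNReal.ofReal (C * r ^ (-(s : ℝ))) →
      A ⊆ (⋃ x ∈ S, Metric.closedBall x r) ∧ (S.card : ℝ≥0∞) = coverNum r.toNNReal A := by
    intro r
    by_cases hr : 0 < r ∧
      (coverNum r.toNNReal A : ℝ≥0∞) ≤ ENNReal.ofReal (C * r ^ (-(s : ℝ)))
    · obtain ⟨S, hS⟩ := exists_finset_coverNum hr.1.le
        (ne_top_of_le_ne_top ENNReal.ofReal_ne_top hr.2)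
      exact ⟨S, fun _ _ => hS⟩
    · exact ⟨∅, fun h1 h2 => absurd ⟨h1, h2⟩ hr⟩
  choose S hS using hex
  have hpos : ∀ᶠ r : ℝ in 𝓝[>] 0, 0 < r := eventually_mem_nhdsWithin
  have hdiam : ∀ (x : X) (r : ℝ), 0 < r →
      Metric.ediam (Metric.closedBall x r) ≤ ENNReal.ofReal (2 * r) := by
    intro x r hr
    refine Metric.ediam_le fun y hy z hz => ?_
    rw [edist_dist]
    refine ENNReal.ofReal_le_ofReal ?_
    rw [Metric.mem_closedBall] at hy hz
    linarith [dist_triangle_right y z x]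
  have hlim := Measure.hausdorffMeasure_le_liminf_sum (ι := fun r : ℝ => S r) (s : ℝ) A
    (l := 𝓝[>] (0 : ℝ)) (fun r => ENNReal.ofReal (2 * r)) ?_
    (fun r i => Metric.closedBall (i : X) r) ?_ ?_
  · refine dimH_le_of_hausdorffMeasure_ne_top (ne_top_of_le_ne_top
      (b := ENNReal.ofReal (C * 2 ^ (s : ℝ))) ENNReal.ofReal_ne_top (hlim.trans ?_))
    refine liminf_le_of_frequently_le' (Eventually.frequently ?_)
    filter_upwards [hpos, h] with r hr hr2
    calc ∑ i : S r, Metric.ediam (Metric.closedBall (i : X) r) ^ (s : ℝ)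
        ≤ ∑ i : S r, ENNReal.ofReal (2 * r) ^ (s : ℝ) :=
          Finset.sum_le_sum fun i _ => ENNReal.rpow_le_rpow (hdiam _ _ hr) s.2
      _ = (S r).card * ENNReal.ofReal ((2 * r) ^ (s : ℝ)) := by
          rw [ENNReal.ofReal_rpow_of_pos (by positivity)]
          simp
      _ ≤ ENNReal.ofReal (C * r ^ (-(s : ℝ))) * ENNReal.ofReal ((2 * r) ^ (s : ℝ)) := by
          rw [(hS r hr hr2).2]
          gcongr
      _ = ENNReal.ofReal (C * 2 ^ (s : ℝ)) := by
          rw [← ENNReal.ofReal_mul' (by positivity), Real.mul_rpow two_pos.le hr.le,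
            Real.rpow_neg hr.le]
          congr 1
          have : r ^ (s : ℝ) ≠ 0 := by positivity
          field_simp
  · have h1 : Tendsto (fun r : ℝ => 2 * r) (𝓝[>] 0) (𝓝 (2 * 0)) :=
      ((continuous_const.mul continuous_id).tendsto 0).mono_left nhdsWithin_le_nhds
    simpa using ENNReal.tendsto_ofReal h1
  · filter_upwards [hpos] with r hr i using hdiam _ _ hr
  · filter_upwards [hpos, h] with r hr hr2
    intro x hx
    obtain ⟨y, hy, hxy⟩ := Set.mem_iUnion₂.1 ((hS r hr hr2).1 hx)
    exact Set.mem_iUnion.2 ⟨⟨y, hy⟩, hxy⟩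

/-! ### Tangents -/

section Tangent

variable {E : Type} [NormedAddCommGroup E] [NormedSpace ℝ E]

/-- Tangents at `x` inherit the counting bounds of `K` at `x`. -/
lemma dimH_le_pointwiseAssouadDim {K F : Set E} {x : E} (hF : F ∈ tangents K x) :
    dimH F ≤ pointwiseAssouadDim K x := by
  classical
  refine le_of_forall_gt_imp_ge_of_dense fun t ht => ?_
  obtain ⟨s, hst, C, hC, R₀, hR₀, hb⟩ := exists_coverBoundAt_of_pointwiseAssouadDim_lt ht
  refine le_trans ?_ hst.le
  obtain ⟨-, -, -, l, hl0, hl, hlim⟩ := hF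
  refine dimH_le_of_coverNum_le s (C * 2 ^ (s : ℝ)) ?_
  filter_upwards [Ioo_mem_nhdsGT (zero_lt_one' ℝ)] with r hr
  have h1 : ∀ᶠ k in atTop, Metric.hausdorffEDist
        ((fun y => l k • (y - x)) '' K ∩ Metric.closedBall 0 1) F < ENNReal.ofReal (r / 2) :=
    hlim.eventually (gt_mem_nhds (by simpa using hr.1))
  obtain ⟨k, hk, hlk⟩ := (h1.and (hl.eventually_gt_atTop (1 / R₀))).exists
  have hlk0 := hl0 k
  have hR : (l k)⁻¹ < R₀ := by
    rw [inv_lt_comm₀ hlk0 hR₀]; simpa using hlk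
  have h2 := hb (r / 2 * (l k)⁻¹) (l k)⁻¹ (mul_pos (half_pos hr.1) (by positivity))
    (mul_le_of_le_one_left (by positivity) (by linarith [hr.2])) hR
  obtain ⟨S, hS, hcard⟩ := exists_finset_coverNum
    (mul_pos (half_pos hr.1) (inv_pos.2 hlk0)).le (ne_top_of_le_ne_top ENNReal.ofReal_ne_top h2)
  rw [← hcard] at h2
  refine (coverNum_le_card (S.image fun p => l k • (p - x)) ?_).trans
    ((Nat.cast_le.2 Finset.card_image_le).trans (h2.trans (ENNReal.ofReal_le_ofReal ?_)))
  · intro w hw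
    rw [Metric.hausdorffEDist_comm] at hk
    obtain ⟨g, ⟨⟨y, hy, rfl⟩, hg⟩, hwg⟩ := Metric.exists_edist_lt_of_hausdorffEDist_lt hw hk
    rw [mem_closedBall_zero_iff, norm_smul, Real.norm_of_nonneg hlk0.le] at hg
    have hyx : y ∈ Metric.closedBall x (l k)⁻¹ := by
      rw [Metric.mem_closedBall, dist_eq_norm, ← one_div, le_div_iff₀ hlk0]
      linarith
    obtain ⟨p, hp, hyp⟩ := Set.mem_iUnion₂.1 (hS ⟨hyx, hy⟩)
    refine Set.mem_iUnion₂.2 ⟨_, Finset.mem_image_of_mem _ hp, ?_⟩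
    rw [edist_dist, ENNReal.ofReal_lt_ofReal_iff (half_pos hr.1)] at hwg
    have h3 : dist (l k • (y - x)) (l k • (p - x)) ≤ r / 2 := by
      rw [dist_smul₀, dist_sub_right, Real.norm_of_nonneg hlk0.le]
      rw [Metric.mem_closedBall] at hyp
      calc l k * dist y p ≤ l k * (r / 2 * (l k)⁻¹) := by gcongr
        _ = r / 2 := by field_simp
    rw [Metric.mem_closedBall]
    linarith [dist_triangle w (l k • (y - x)) (l k • (p - x))]
  · have h3 : (l k)⁻¹ / (r / 2 * (l k)⁻¹) = 2 / r := by
      have := hr.1.ne'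
      field_simp
    rw [h3, Real.div_rpow two_pos.le hr.1.le, Real.rpow_neg hr.1.le]
    exact le_of_eq (by ring)

/-- Content of `K` at `x` that persists along finer and finer resolutions is inherited by a tangent
at `x`: Hausdorff content is upper semicontinuous along Hausdorff convergence of compact sets. -/
lemma exists_tangent_of_hasContent [ProperSpace E] [MeasurableSpace E] [BorelSpace E]
    {K : Set E} (hK : IsCompact K)
    {x : E} (hx : x ∈ K) {c α : ℝ} (hα : 0 ≤ α) (hc : c ≤ 1)
    (h : ∀ ε > 0, ∃ R, 0 < R ∧ R < ε ∧ HasContent (Metric.closedBall x R ∩ K) R ε c α) :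
    ∃ F ∈ tangents K x, ENNReal.ofReal c ≤ μH[α] F := by
  have hN : ∀ k : ℕ, (0 : ℝ) < 1 / (k + 1) := fun k => Nat.one_div_pos_of_nat
  choose R hR0 hR hcont using fun k : ℕ => h (1 / (k + 1)) (hN k)
  have hne : ∀ l : ℝ, ((fun y => l • (y - x)) '' K ∩ Metric.closedBall (0 : E) 1).Nonempty :=
    fun l => ⟨0, ⟨x, hx, by simp⟩, by simp⟩
  have hcpt : ∀ l : ℝ, IsCompact ((fun y => l • (y - x)) '' K ∩ Metric.closedBall (0 : E) 1) :=
    fun l => (hK.image (by fun_prop)).inter_right Metric.isClosed_closedBall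
  let G : ℕ → TopologicalSpace.NonemptyCompacts E := fun k => ⟨⟨_, hcpt (R k)⁻¹⟩, hne _⟩
  obtain ⟨F, hF, φ, hφ, hlim⟩ :=
    (TopologicalSpace.NonemptyCompacts.isCompact_subsets_of_isCompact
      (isCompact_closedBall (0 : E) 1)).tendsto_subseq (x := G)
      (fun k => (Set.inter_subset_right : _ ∩ Metric.closedBall (0 : E) 1 ⊆ _))
  have hlim' : Tendsto (fun k => Metric.hausdorffEDist
      ((fun y => (R (φ k))⁻¹ • (y - x)) '' K ∩ Metric.closedBall 0 1) (F : Set E)) atTop (𝓝 0) :=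
    tendsto_iff_edist_tendsto_0.1 hlim
  have hRlim : Tendsto R atTop (𝓝[>] 0) := by
    refine tendsto_nhdsWithin_iff.2 ⟨squeeze_zero (fun k => (hR0 k).le) (fun k => (hR k).le)
      tendsto_one_div_add_atTop_nhds_zero_nat, Eventually.of_forall hR0⟩
  refine ⟨F, ⟨F.nonempty, F.isCompact, hF, fun k => (R (φ k))⁻¹, fun k => inv_pos.2 (hR0 _),
    (tendsto_inv_nhdsGT_zero.comp hRlim).comp hφ.tendsto_atTop, hlim'⟩, ?_⟩
  rcases hα.eq_or_lt with rfl | hα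
  · obtain ⟨w, hw⟩ := F.nonempty
    calc ENNReal.ofReal c ≤ 1 := by simpa using hc
      _ = μH[0] {w} := (Measure.hausdorffMeasure_zero_singleton w).symm
      _ ≤ _ := measure_mono (by simpa using hw)
  by_contra! hlt
  rw [Measure.hausdorffMeasure_apply] at hlt
  have hlt1 := (le_iSup₂ (f := fun (r : ℝ≥0∞) (_ : 0 < r) =>
    ⨅ (t : ℕ → Set E) (_ : (F : Set E) ⊆ ⋃ n, t n) (_ : ∀ n, Metric.ediam (t n) ≤ r),
      ∑' n, ⨆ _ : (t n).Nonempty, Metric.ediam (t n) ^ α) 1 one_pos).trans_lt hlt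
  simp only [iInf_lt_iff] at hlt1
  obtain ⟨t, ht, htd, hsum⟩ := hlt1
  -- enlarge the sets of the cover to open balls, at an arbitrarily small cost
  obtain ⟨η, hη0, hη⟩ := ENNReal.exists_pos_sum_of_countable'
    (tsub_pos_of_lt hsum).ne' ℕ
  have hfin : ∀ n, Metric.ediam (t n) ≠ ⊤ := fun n => ne_top_of_le_ne_top ENNReal.one_ne_top (htd n)
  have hδ : ∀ n, ∃ δ : ℝ, 0 < δ ∧
      ENNReal.ofReal (((Metric.ediam (t n)).toReal + δ) ^ α) ≤ Metric.ediam (t n) ^ α + η n := by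
    intro n
    have h1 : Tendsto (fun δ : ℝ => ENNReal.ofReal (((Metric.ediam (t n)).toReal + δ) ^ α)) (𝓝[>] 0)
        (𝓝 (ENNReal.ofReal (((Metric.ediam (t n)).toReal + 0) ^ α))) := by
      have : Continuous fun δ : ℝ => ENNReal.ofReal (((Metric.ediam (t n)).toReal + δ) ^ α) :=
        ENNReal.continuous_ofReal.comp
          ((Real.continuous_rpow_const hα.le).comp (continuous_const.add continuous_id))
      exact (this.tendsto 0).mono_left nhdsWithin_le_nhds
    have h2 : ENNReal.ofReal (((Metric.ediam (t n)).toReal + 0) ^ α) <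
        Metric.ediam (t n) ^ α + η n := by
      rw [add_zero, ← ENNReal.ofReal_rpow_of_nonneg ENNReal.toReal_nonneg hα.le,
        ENNReal.ofReal_toReal (hfin n)]
      exact ENNReal.lt_add_right (ENNReal.rpow_ne_top_of_nonneg hα.le (hfin n)) (hη0 n).ne'
    have h3 : ∀ᶠ δ : ℝ in 𝓝[>] 0, 0 < δ := eventually_mem_nhdsWithin
    obtain ⟨δ, h4, h5⟩ := ((h1.eventually (gt_mem_nhds h2)).and h3).exists
    exact ⟨δ, h5, h4.le⟩
  choose δ hδ0 hδ using hδ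
  have hp : ∀ n, ∃ p : E, (t n).Nonempty → p ∈ t n := fun n => by
    by_cases h : (t n).Nonempty
    · obtain ⟨p, hp⟩ := h; exact ⟨p, fun _ => hp⟩
    · exact ⟨0, fun h' => absurd h' h⟩
  choose p hp using hp
  set ρ : ℕ → ℝ := fun n => (Metric.ediam (t n)).toReal + δ n with hρ
  have hρ0 : ∀ n, 0 < ρ n := fun n => add_pos_of_nonneg_of_pos ENNReal.toReal_nonneg (hδ0 n)
  classical
  let U : ℕ → Set E := fun n => if (t n).Nonempty then Metric.ball (p n) (ρ n) else ∅
  have hUo : ∀ n, IsOpen (U n) := fun n => by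
    by_cases h : (t n).Nonempty
    · simp only [U, if_pos h]; exact Metric.isOpen_ball
    · simp only [U, if_neg h]; exact isOpen_empty
  have htU : ∀ n, t n ⊆ U n := by
    intro n y hy
    have hn : (t n).Nonempty := ⟨y, hy⟩
    simp only [U, if_pos hn, Metric.mem_ball]
    have h1 := Metric.edist_le_ediam_of_mem hy (hp n hn)
    rw [edist_dist] at h1
    have h2 := ENNReal.ofReal_le_iff_le_toReal (hfin n) |>.1 h1
    have := hδ0 n
    simp only [hρ]
    linarith
  obtain ⟨I, hI⟩ := F.isCompact.elim_finite_subcover U hUo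
    (ht.trans (Set.iUnion_mono htU))
  set J := I.filter fun n => (t n).Nonempty with hJ
  have hJcov : (F : Set E) ⊆ ⋃ n ∈ J, Metric.ball (p n) (ρ n) := by
    intro y hy
    obtain ⟨n, hn, hyn⟩ := Set.mem_iUnion₂.1 (hI hy)
    by_cases h : (t n).Nonempty
    · simp only [U, if_pos h] at hyn
      exact Set.mem_iUnion₂.2 ⟨n, Finset.mem_filter.2 ⟨hn, h⟩, hyn⟩
    · simp only [U, if_neg h] at hyn
      exact hyn.elim
  have hJsum : ∑ n ∈ J, ρ n ^ α < c := by
    have h1 : ENNReal.ofReal (∑ n ∈ J, ρ n ^ α) < ENNReal.ofReal c := by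
      rw [ENNReal.ofReal_sum_of_nonneg (fun n _ => Real.rpow_nonneg (hρ0 n).le _)]
      calc ∑ n ∈ J, ENNReal.ofReal (ρ n ^ α)
          ≤ ∑ n ∈ J, ((⨆ _ : (t n).Nonempty, Metric.ediam (t n) ^ α) + η n) := by
            refine Finset.sum_le_sum fun n hn => ?_
            rw [iSup_pos (Finset.mem_filter.1 hn).2]
            exact hδ n
        _ ≤ ∑' n, ((⨆ _ : (t n).Nonempty, Metric.ediam (t n) ^ α) + η n) := ENNReal.sum_le_tsum _
        _ = (∑' n, ⨆ _ : (t n).Nonempty, Metric.ediam (t n) ^ α) + ∑' n, η n := ENNReal.tsum_add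
        _ < (∑' n, ⨆ _ : (t n).Nonempty, Metric.ediam (t n) ^ α) + (ENNReal.ofReal c -
              ∑' n, ⨆ _ : (t n).Nonempty, Metric.ediam (t n) ^ α) :=
            ENNReal.add_lt_add_left hsum.ne_top hη
        _ = ENNReal.ofReal c := add_tsub_cancel_of_le hsum.le
    exact (ENNReal.ofReal_lt_ofReal_iff'.1 h1).1
  obtain ⟨κ, hκ0, hκ⟩ := F.isCompact.exists_thickening_subset_open
    (isOpen_biUnion fun n _ => Metric.isOpen_ball) hJcov
  -- at a late stage the finite cover of `F` covers the blow-up, with radii above the resolution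
  have hev1 : ∀ᶠ k in atTop, Metric.hausdorffEDist
      ((fun y => (R (φ k))⁻¹ • (y - x)) '' K ∩ Metric.closedBall 0 1) (F : Set E) <
        ENNReal.ofReal κ := hlim'.eventually (gt_mem_nhds (by simpa using hκ0))
  have hev2 : ∀ᶠ k in atTop, ∀ n ∈ J, 1 / ((φ k : ℝ) + 1) < ρ n := by
    rw [Filter.eventually_all_finset]
    intro n _
    exact (tendsto_one_div_add_atTop_nhds_zero_nat.comp hφ.tendsto_atTop).eventually
      (gt_mem_nhds (hρ0 n))
  obtain ⟨k, hk1, hk2⟩ := (hev1.and hev2).exists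
  have hr := hR0 (φ k)
  have hfinal := hcont (φ k) ℕ J (fun n => x + R (φ k) • p n) (fun n => R (φ k) * ρ n) ?_ ?_
  · have h1 : ∑ n ∈ J, (R (φ k) * ρ n) ^ α = R (φ k) ^ α * ∑ n ∈ J, ρ n ^ α := by
      rw [Finset.mul_sum]
      exact Finset.sum_congr rfl fun n _ => Real.mul_rpow hr.le (hρ0 n).le
    rw [h1, mul_comm] at hfinal
    exact absurd (le_of_mul_le_mul_left hfinal (by positivity)) (not_le.2 hJsum)
  · intro n hn
    rw [mul_comm]
    exact mul_le_mul_of_nonneg_left (hk2 n hn).le hr.le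
  · rintro y ⟨hyx, hy⟩
    have hmem : (R (φ k))⁻¹ • (y - x) ∈
        (fun y => (R (φ k))⁻¹ • (y - x)) '' K ∩ Metric.closedBall 0 1 := by
      refine ⟨⟨y, hy, rfl⟩, ?_⟩
      rw [mem_closedBall_zero_iff, norm_smul, norm_inv, Real.norm_of_nonneg hr.le,
        inv_mul_le_iff₀ hr, mul_one, ← dist_eq_norm]
      exact hyx
    obtain ⟨w, hw, hyw⟩ := Metric.exists_edist_lt_of_hausdorffEDist_lt hmem hk1
    rw [edist_lt_ofReal] at hyw
    obtain ⟨n, hn, hyn⟩ := Set.mem_iUnion₂.1 (hκ (Metric.mem_thickening_iff.2 ⟨w, hw, hyw⟩))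
    refine Set.mem_iUnion₂.2 ⟨n, hn, ?_⟩
    have h1 : y - (x + R (φ k) • p n) = R (φ k) • ((R (φ k))⁻¹ • (y - x) - p n) := by
      rw [smul_sub, smul_inv_smul₀ hr.ne']; abel
    rw [Metric.mem_closedBall, dist_eq_norm, h1, norm_smul, Real.norm_of_nonneg hr.le,
      ← dist_eq_norm]
    exact mul_le_mul_of_nonneg_left (Metric.mem_ball.1 hyn).le hr.le

end Tangent

/-! ### The upper box dimension -/

section BoxDim

variable {X : Type*} [PseudoMetricSpace X]

lemma lt_boxQuotient_iff {A : Set X} {s r : ℝ≥0} (hr : 0 < r) (hr1 : r < 1) :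
    (s : ℝ≥0∞) < (ENNReal.log (coverNum r A : ℝ≥0∞) /
        ((Real.log (1 / (r : ℝ)) : ℝ) : EReal)).toENNReal ↔
      ENNReal.ofReal ((r : ℝ) ^ (-(s : ℝ))) < coverNum r A := by
  have hr' : (0 : ℝ) < r := hr
  have hL : 0 < Real.log (1 / (r : ℝ)) :=
    Real.log_pos ((one_lt_div hr').2 (by exact_mod_cast hr1))
  have h1 : ENNReal.log (ENNReal.ofReal ((r : ℝ) ^ (-(s : ℝ)))) =
      ((s : ℝ) : EReal) * ((Real.log (1 / (r : ℝ)) : ℝ) : EReal) := by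
    rw [ENNReal.log_ofReal_of_pos (by positivity), Real.log_rpow hr', one_div, Real.log_inv,
      ← EReal.coe_mul]
    congr 1; ring
  rw [← ENNReal.log_lt_log_iff (x := ENNReal.ofReal ((r : ℝ) ^ (-(s : ℝ)))), h1,
    ← EReal.lt_div_iff (by exact_mod_cast hL) (EReal.coe_ne_top _)]
  set q := ENNReal.log (coverNum r A : ℝ≥0∞) / ((Real.log (1 / (r : ℝ)) : ℝ) : EReal)
  rw [← EReal.coe_ennreal_lt_coe_ennreal_iff, EReal.coe_toENNReal_eq_max,
    EReal.coe_nnreal_eq_coe_real, lt_max_iff]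
  refine or_iff_right fun h => ?_
  have : (0 : EReal) ≤ ((s : ℝ) : EReal) := by exact_mod_cast s.2
  exact absurd h (not_lt.2 this)

lemma tendsto_toNNReal_nhdsGT_zero : Tendsto Real.toNNReal (𝓝[>] 0) (𝓝[>] 0) := by
  refine tendsto_nhdsWithin_iff.2 ⟨?_, ?_⟩
  · have := continuous_real_toNNReal.tendsto 0
    rw [Real.toNNReal_zero] at this
    exact this.mono_left nhdsWithin_le_nhds
  · filter_upwards [eventually_mem_nhdsWithin] with r hr
    simpa using hr

lemma coverNum_le_of_upperBoxDim_lt {A : Set X} {s : ℝ≥0} (h : upperBoxDim A < s) :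
    ∀ᶠ r : ℝ in 𝓝[>] 0, (coverNum r.toNNReal A : ℝ≥0∞) ≤ ENNReal.ofReal (r ^ (-(s : ℝ))) := by
  have h1 := tendsto_toNNReal_nhdsGT_zero.eventually (eventually_lt_of_limsup_lt h)
  filter_upwards [h1, Ioo_mem_nhdsGT (zero_lt_one' ℝ)] with r hr hr01
  have h2 := (lt_boxQuotient_iff (A := A) (s := s) (r := r.toNNReal) (by simpa using hr01.1)
    (by simpa using hr01.2)).not.1 hr.not_gt
  rwa [not_lt, Real.coe_toNNReal _ hr01.1.le] at h2

lemma exists_lt_coverNum_of_lt_upperBoxDim {A : Set X} {s : ℝ≥0} (h : s < upperBoxDim A)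
    {p : ℝ → Prop} (hp : ∀ᶠ r : ℝ in 𝓝[>] 0, p r) :
    ∃ r : ℝ, 0 < r ∧ p r ∧ ENNReal.ofReal (r ^ (-(s : ℝ))) < coverNum r.toNNReal A := by
  have hcoe : Tendsto ((↑) : ℝ≥0 → ℝ) (𝓝[>] 0) (𝓝[>] 0) := by
    refine tendsto_nhdsWithin_iff.2 ⟨?_, ?_⟩
    · have := NNReal.continuous_coe.tendsto 0
      rw [NNReal.coe_zero] at this
      exact this.mono_left nhdsWithin_le_nhds
    · filter_upwards [eventually_mem_nhdsWithin] with r hr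
      simpa using hr
  have h1 := frequently_lt_of_lt_limsup (by isBoundedDefault) h
  have h2 : ∀ᶠ r : ℝ≥0 in 𝓝[>] 0, r ∈ Set.Ioo 0 1 := Ioo_mem_nhdsGT one_pos
  obtain ⟨r, hr, hr01, hpr⟩ := (h1.and_eventually (h2.and (hcoe.eventually hp))).exists
  refine ⟨r, by exact_mod_cast hr01.1, hpr, ?_⟩
  rw [Real.toNNReal_coe]
  exact (lt_boxQuotient_iff hr01.1 hr01.2).1 hr

lemma upperBoxDim_le_of_coverNum_le {A : Set X} (s : ℝ≥0) (C : ℝ)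
    (h : ∀ᶠ r : ℝ in 𝓝[>] 0,
      (coverNum r.toNNReal A : ℝ≥0∞) ≤ ENNReal.ofReal (C * r ^ (-(s : ℝ)))) :
    upperBoxDim A ≤ s := by
  by_contra! hlt
  obtain ⟨s', hs, hs'⟩ := ENNReal.lt_iff_exists_nnreal_btwn.1 hlt
  have hss : (0 : ℝ) < s' - s := by
    have : s < s' := by exact_mod_cast hs
    exact sub_pos.2 (by exact_mod_cast this)
  have h1 : Tendsto (fun r : ℝ => C * r ^ (s' - s : ℝ)) (𝓝[>] 0) (𝓝 (C * 0 ^ (s' - s : ℝ))) := by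
    have : Continuous fun r : ℝ => C * r ^ (s' - s : ℝ) :=
      continuous_const.mul (Real.continuous_rpow_const hss.le)
    exact (this.tendsto 0).mono_left nhdsWithin_le_nhds
  rw [Real.zero_rpow hss.ne', mul_zero] at h1
  obtain ⟨r, hr0, ⟨hr1, hr2⟩, hr3⟩ :=
    exists_lt_coverNum_of_lt_upperBoxDim hs' (h.and (h1.eventually (gt_mem_nhds one_pos)))
  have h2 := (ENNReal.ofReal_lt_ofReal_iff'.1 (hr3.trans_le hr1)).1
  have h3 : C * r ^ (-(s : ℝ)) = C * r ^ (s' - s : ℝ) * r ^ (-(s' : ℝ)) := by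
    rw [mul_assoc, ← Real.rpow_add hr0]
    congr 2; ring
  rw [h3] at h2
  have h4 : 0 < r ^ (-(s' : ℝ)) := by positivity
  nlinarith

lemma dimH_le_upperBoxDim {Y : Type*} [MetricSpace Y] (A : Set Y) : dimH A ≤ upperBoxDim A := by
  refine le_of_forall_gt_imp_ge_of_dense fun t ht => ?_
  obtain ⟨s, hs, hst⟩ := ENNReal.lt_iff_exists_nnreal_btwn.1 ht
  refine (dimH_le_of_coverNum_le s 1 ?_).trans hst.le
  simpa using coverNum_le_of_upperBoxDim_lt hs

end BoxDim

/-! ### Embeddings at all scales -/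

section Embedding

variable {X : Type*} [PseudoMetricSpace X]

lemma HasEmbedding.mono_const {K : Set X} {z : X} {r a a' : ℝ} (h : HasEmbedding K z r a)
    (ha' : 0 < a') (haa : a' ≤ a) (hr : 0 ≤ r) : HasEmbedding K z r a' := by
  obtain ⟨f, hf, hd⟩ := h
  refine ⟨f, hf, fun x hx y hy => ⟨le_trans ?_ (hd x hx y hy).1, (hd x hx y hy).2.trans ?_⟩⟩ <;>
  gcongr

/-- A set of diameter `0` embeds into each of its balls by the identity, so that the restriction
`r ≤ diam K` in the definition of self-embeddability can be dropped. -/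
lemma IsSelfEmbeddable.exists_embedding {K : Set X} (hK : Bornology.IsBounded K)
    (h : IsSelfEmbeddable K) {z : X} (hz : z ∈ K) {r : ℝ} (hr : 0 < r) :
    ∃ (f : X → X) (l L : ℝ), 0 < l ∧ Set.MapsTo f K (Metric.closedBall z r ∩ K) ∧
      ∀ x ∈ K, ∀ y ∈ K, l * dist x y ≤ dist (f x) (f y) ∧ dist (f x) (f y) ≤ L * dist x y := by
  rcases (Metric.diam_nonneg (s := K)).eq_or_lt with h0 | h0
  · refine ⟨id, 1, 1, one_pos, fun x hx => ⟨?_, hx⟩, fun x _ y _ => by simp⟩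
    have := Metric.dist_le_diam_of_mem hK hx hz
    rw [Metric.mem_closedBall, id]
    linarith
  · have hr' : 0 < min r (Metric.diam K) := lt_min hr h0
    obtain ⟨a, ha, f, hf, hd⟩ := h z hz _ hr' (min_le_right _ _)
    exact ⟨f, _, _, mul_pos ha hr', fun x hx => ⟨Metric.closedBall_subset_closedBall
      (min_le_left _ _) (hf hx).1, (hf hx).2⟩, hd⟩

lemma IsUniformlySelfEmbeddable.exists_hasEmbedding {K : Set X} (hK : Bornology.IsBounded K)
    (h : IsUniformlySelfEmbeddable K) : ∃ a : ℝ, 0 < a ∧ a ≤ 1 ∧ ∀ z ∈ K, ∀ r : ℝ, 0 < r → r ≤ 1 →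
      HasEmbedding K z r a := by
  rcases (Metric.diam_nonneg (s := K)).eq_or_lt with h0 | h0
  · have hd : ∀ x ∈ K, ∀ y ∈ K, dist x y = 0 := fun x hx y hy =>
      le_antisymm (h0 ▸ Metric.dist_le_diam_of_mem hK hx hy) dist_nonneg
    refine ⟨1, one_pos, le_rfl, fun z hz r hr _ => ⟨id, fun x hx => ⟨?_, hx⟩, fun x hx y hy => ?_⟩⟩
    · rw [Metric.mem_closedBall, id, hd x hx z hz]; exact hr.le
    · simp [hd x hx y hy]
  · obtain ⟨a, ha, h⟩ := h
    set m := min 1 (Metric.diam K) with hm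
    have hm0 : 0 < m := lt_min one_pos h0
    have hm1 : m ≤ 1 := min_le_left _ _
    have key : ∀ z ∈ K, ∀ r : ℝ, 0 < r → r ≤ 1 → HasEmbedding K z r (a * m) := by
      intro z hz r hr hr1
      have hle : r * m ≤ Metric.diam K :=
        (mul_le_of_le_one_left hm0.le hr1).trans (min_le_right _ _)
      obtain ⟨f, hf, hd⟩ := h z hz (r * m) (by positivity) hle
      have hrm : r * m ≤ r := mul_le_of_le_one_right hr.le hm1
      refine ⟨f, fun x hx => ⟨Metric.closedBall_subset_closedBall hrm (hf hx).1, (hf hx).2⟩,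
        fun x hx y hy => ⟨le_trans (le_of_eq (by ring)) (hd x hx y hy).1,
          (hd x hx y hy).2.trans ?_⟩⟩
      gcongr
      exact mul_le_of_le_one_right ha.le hm1
    exact ⟨min 1 (a * m), by positivity, min_le_left _ _, fun z hz r hr hr1 =>
      (key z hz r hr hr1).mono_const (by positivity) (min_le_right _ _) hr.le⟩

/-- A single bi-Lipschitz copy of `K` near `x` transports the counting bounds at `x` to `K`. -/
lemma IsSelfEmbeddable.upperBoxDim_le {K : Set X} (hK : Bornology.IsBounded K)
    (h : IsSelfEmbeddable K) {x : X} (hx : x ∈ K) :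
    upperBoxDim K ≤ pointwiseAssouadDim K x := by
  refine le_of_forall_gt_imp_ge_of_dense fun t ht => ?_
  obtain ⟨s, hst, C, hC, R₀, hR₀, hb⟩ := exists_coverBoundAt_of_pointwiseAssouadDim_lt ht
  refine le_trans ?_ hst.le
  obtain ⟨f, l, L, hl, hf, hd⟩ := h.exists_embedding hK hx (half_pos hR₀)
  refine upperBoxDim_le_of_coverNum_le s (C * (R₀ / l) ^ (s : ℝ)) ?_
  filter_upwards [Ioo_mem_nhdsGT (div_pos hR₀ hl)] with r hr
  have hr0 := hr.1
  have hlr : l * r < R₀ := by have := (lt_div_iff₀ hl).1 hr.2; linarith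
  refine (coverNum_le_of_expanding hl hr0.le hf fun x hx y hy => (hd x hx y hy).1).trans
    ((hb (l * r / 2) (R₀ / 2) (by positivity) (by linarith) (by linarith)).trans
      (ENNReal.ofReal_le_ofReal (le_of_eq ?_)))
  rw [Real.rpow_neg hr0.le, mul_assoc, ← Real.inv_rpow hr0.le,
    ← Real.mul_rpow (by positivity) (by positivity)]
  congr 2
  field_simp

end Embedding

/-! ### Points with large content at arbitrarily small scales -/

section Points

variable {X : Type*} [PseudoMetricSpace X]

/-- The points of `K` around which `K` has large `α`-dimensional content at arbitrarily small scales
and arbitrarily fine resolutions. At such points there are tangents of positive `α`-dimensional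
measure, see `exists_tangent_of_hasContent`. -/
def richPoints (K : Set X) (c α : ℝ) : Set X :=
  {x ∈ K | ∀ ε > 0, ∃ R, 0 < R ∧ R < ε ∧ HasContent (Metric.closedBall x R ∩ K) R ε c α}

lemma richPoints_mono {K : Set X} {c c' α : ℝ} (hc : c' ≤ c) :
    richPoints K c α ⊆ richPoints K c' α := fun _ hx => ⟨hx.1, fun ε hε => by
  obtain ⟨R, h1, h2, h3⟩ := hx.2 ε hε
  exact ⟨R, h1, h2, h3.mono_const h1.le hc⟩⟩

/-- A point belongs to `richPoints` as soon as balls of large content come within distance of their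
own radius. -/
lemma mem_richPoints_of_near {K : Set X} {x : X} (hx : x ∈ K) {c α : ℝ}
    (h : ∀ k : ℕ, ∃ z R, 0 < R ∧ R ≤ 1 / ((k : ℝ) + 1) ∧ dist z x ≤ R ∧
      HasContent (Metric.closedBall z R ∩ K) R (1 / ((k : ℝ) + 1)) c α) :
    x ∈ richPoints K (c * 2 ^ (-α)) α := by
  refine ⟨hx, fun ε hε => ?_⟩
  obtain ⟨k, hk⟩ := exists_nat_one_div_lt (half_pos hε)
  obtain ⟨z, R, hR, hRk, hz, hcont⟩ := h k
  have hk0 : (0 : ℝ) < 1 / ((k : ℝ) + 1) := Nat.one_div_pos_of_nat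
  refine ⟨2 * R, by positivity, by linarith,
    ((hcont.double hR.le hk0.le).mono_set ?_).mono_resolution (by positivity) (by linarith)⟩
  exact Set.inter_subset_inter_left K (Metric.closedBall_subset_closedBall' (by linarith))

lemma exists_limit_of_nested {K : Set X} (hK : IsCompact K) [T2Space X] {z : ℕ → X} {ρ : ℕ → ℝ}
    (hz : ∀ n, z n ∈ K) (hρ0 : ∀ n, 0 < ρ n) (hρ : ∀ n, ρ (n + 1) ≤ ρ n / 2)
    (hd : ∀ n, dist (z (n + 1)) (z n) ≤ ρ n / 2) : ∃ x ∈ K, ∀ n, dist (z n) x ≤ ρ n := by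
  have hne : (⋂ n, Metric.closedBall (z n) (ρ n) ∩ K).Nonempty := by
    refine IsCompact.nonempty_iInter_of_sequence_nonempty_isCompact_isClosed _ (fun n => ?_)
      (fun n => ⟨z n, Metric.mem_closedBall_self (hρ0 n).le, hz n⟩)
      (hK.inter_left Metric.isClosed_closedBall)
      (fun n => Metric.isClosed_closedBall.inter hK.isClosed)
    refine Set.inter_subset_inter_left K (Metric.closedBall_subset_closedBall' ?_)
    linarith [hρ n, hd n]
  obtain ⟨x, hx⟩ := hne
  rw [Set.mem_iInter] at hx
  exact ⟨x, (hx 0).2, fun n => by rw [dist_comm]; exact (hx n).1⟩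

/-- In a self-embeddable set one can pass from any ball to a bi-Lipschitz copy of `K` inside it, and
from there to a smaller ball of large content. Since `exists_hasContent_image` has a constant
independent of the copy, no control of the bi-Lipschitz constants is needed. -/
lemma IsSelfEmbeddable.richPoints_nonempty [T2Space X] {K : Set X} (hK : IsCompact K)
    (hne : K.Nonempty) (h : IsSelfEmbeddable K) {α : ℝ≥0} (hα : assouadDim K = α) :
    (richPoints K (4 ^ (-α : ℝ) * 2 ^ (-α : ℝ)) α).Nonempty := by
  have step : ∀ (n : ℕ) (p : {p : X × ℝ // p.1 ∈ K ∧ 0 < p.2}),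
      ∃ p' : {p : X × ℝ // p.1 ∈ K ∧ 0 < p.2}, p'.1.2 ≤ p.1.2 / 2 ∧
        dist p'.1.1 p.1.1 ≤ p.1.2 / 2 ∧ ∃ R, 0 < R ∧ R ≤ 1 / ((n : ℝ) + 1) ∧ p'.1.2 ≤ R ∧
          HasContent (Metric.closedBall p'.1.1 R ∩ K) R (1 / ((n : ℝ) + 1)) (4 ^ (-α : ℝ)) α := by
    rintro n ⟨⟨z, ρ⟩, hz, hρ⟩
    simp only at hz hρ
    have hn : (0 : ℝ) < 1 / ((n : ℝ) + 1) := Nat.one_div_pos_of_nat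
    obtain ⟨f, l, L, hl, hf, hd⟩ := h.exists_embedding hK.isBounded hz (half_pos hρ)
    obtain ⟨y, ⟨w, hw, rfl⟩, R, hR, hRn, hcont⟩ :=
      exists_hasContent_image hK hne hα hl hd hn hn
    refine ⟨⟨⟨f w, min (ρ / 2) R⟩, (hf hw).2, lt_min (half_pos hρ) hR⟩, min_le_left _ _, (hf hw).1,
      R, hR, hRn.le, min_le_right _ _, hcont.mono_set (Set.inter_subset_inter_right _ ?_)⟩
    rintro _ ⟨v, hv, rfl⟩
    exact (hf hv).2
  choose g hg1 hg2 hg3 using step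
  obtain ⟨z₀, hz₀⟩ := hne
  let p : ℕ → {p : X × ℝ // p.1 ∈ K ∧ 0 < p.2} := fun n =>
    Nat.rec ⟨(z₀, 1), hz₀, one_pos⟩ (fun n q => g n q) n
  obtain ⟨x, hxK, hx⟩ := exists_limit_of_nested hK (z := fun n => (p n).1.1)
    (ρ := fun n => (p n).1.2) (fun n => (p n).2.1) (fun n => (p n).2.2)
    (fun n => hg1 n (p n)) (fun n => hg2 n (p n))
  refine ⟨x, mem_richPoints_of_near hxK fun k => ?_⟩
  obtain ⟨R, hR, hRk, hpR, hcont⟩ := hg3 k (p k)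
  exact ⟨(p (k + 1)).1.1, R, hR, hRk, (hx (k + 1)).trans hpR, hcont⟩

end Points

/-! ### Cantor sets of large dimension -/

/-- A coded set in which words that first differ at position `n` are `δ n` apart has dimension at
least `s` if `N ^ (-n)` is dominated by `δ n ^ s`: reading codes as base `N` expansions maps the set
onto `[0, 1]` by a Hölder map of exponent `s`. -/
lemma le_dimH_range_of_separated {X : Type*} [MetricSpace X] {N : ℕ} (hN : 1 < N) {s C : ℝ≥0}
    (hs : 0 < s) {δ : ℕ → ℝ} (hδ : ∀ n, 0 < δ n) (π : (ℕ → Fin N) → X)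
    (hπ : ∀ u v n, (∀ i < n, u i = v i) → u n ≠ v n → δ n ≤ dist (π u) (π v))
    (hC : ∀ n, ((N : ℝ) ^ n)⁻¹ ≤ C * δ n ^ (s : ℝ)) : (s : ℝ≥0∞) ≤ dimH (Set.range π) := by
  have : NeZero N := ⟨by omega⟩
  have hfirst : ∀ u v : ℕ → Fin N, u ≠ v → ∃ n, (∀ i < n, u i = v i) ∧ u n ≠ v n := by
    classical
    intro u v huv
    have hex : ∃ n, u n ≠ v n := Function.ne_iff.1 huv
    exact ⟨Nat.find hex, fun i hi => not_not.1 (Nat.find_min hex hi), Nat.find_spec hex⟩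
  have hinj : Function.Injective π := by
    intro u v huv
    by_contra hne
    obtain ⟨n, h1, h2⟩ := hfirst u v hne
    have := hπ u v n h1 h2
    rw [huv, dist_self] at this
    exact absurd this (not_le.2 (hδ n))
  let h : X → ℝ := fun x => Real.ofDigits (Function.invFun π x)
  have hπh : ∀ u, h (π u) = Real.ofDigits u := fun u => by
    simp only [h, Function.leftInverse_invFun hinj u]
  have hhol : HolderOnWith C s h (Set.range π) := by
    rintro _ ⟨u, rfl⟩ _ ⟨v, rfl⟩
    rw [hπh, hπh]
    rcases eq_or_ne u v with rfl | hne
    · simp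
    obtain ⟨n, h1, h2⟩ := hfirst u v hne
    rw [edist_dist, edist_dist, ENNReal.ofReal_rpow_of_nonneg dist_nonneg s.coe_nonneg,
      ← ENNReal.ofReal_coe_nnreal, ← ENNReal.ofReal_mul C.coe_nonneg]
    refine ENNReal.ofReal_le_ofReal ?_
    rw [Real.dist_eq]
    refine (Real.abs_ofDigits_sub_ofDigits_le h1).trans ((hC n).trans ?_)
    gcongr
    · exact (hδ n).le
    · exact hπ u v n h1 h2
  have himg : Set.Icc (0 : ℝ) 1 ⊆ h '' Set.range π := by
    intro y hy
    obtain ⟨u, -, rfl⟩ := Real.ofDigits_SurjOn hN hy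
    exact ⟨π u, ⟨u, rfl⟩, hπh u⟩
  have h1 : dimH (Set.Icc (0 : ℝ) 1) = 1 := by
    simpa using Real.dimH_of_nonempty_interior (E := ℝ) (s := Set.Icc (0 : ℝ) 1) (by simp)
  have h2 := (h1 ▸ dimH_mono himg).trans (hhol.dimH_image_le hs)
  rwa [ENNReal.le_div_iff_mul_le (Or.inl (by simpa using hs.ne')) (Or.inl ENNReal.coe_ne_top),
    one_mul] at h2

/-- A counter `κ` that grows so slowly that the accumulated cost `∏ η` of its increments is
negligible against the geometric sequence `q ^ n`. -/
lemma exists_slow_counter {η : ℕ → ℝ} (hη : ∀ k, 0 < η k) {q s : ℝ} (hq0 : 0 < q) (hq1 : q < 1) :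
    ∃ κ : ℕ → ℕ, (∀ n, κ (n + 1) = κ n ∨ κ (n + 1) = κ n + 1) ∧
      (∀ k, ∃ n, κ n = k ∧ κ (n + 1) = k + 1) ∧
      ∀ n, q ^ n ≤ (∏ i ∈ Finset.range (κ (n + 1)), η i) ^ s := by
  classical
  set P : ℕ → ℝ := fun k => (∏ i ∈ Finset.range k, η i) ^ s with hP
  have hP0 : ∀ k, 0 < P k := fun k => Real.rpow_pos_of_pos (Finset.prod_pos fun i _ => hη i) s
  let κ : ℕ → ℕ := fun n => Nat.rec 0 (fun n k => if q ^ n ≤ P (k + 1) then k + 1 else k) n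
  have hκ : ∀ n, κ (n + 1) = if q ^ n ≤ P (κ n + 1) then κ n + 1 else κ n := fun n => rfl
  have hex : ∀ k, (∃ n, κ n = k) → ∃ n, κ n = k ∧ κ (n + 1) = k + 1 := by
    rintro k ⟨n₀, hn₀⟩
    by_contra! hcon
    have hconst : ∀ m, κ (n₀ + m) = k := by
      intro m
      induction m with
      | zero => exact hn₀
      | succ m ih =>
        have h1 := hcon _ ih
        have h2 := hκ (n₀ + m)
        rw [ih] at h2
        split_ifs at h2 with h3
        · exact absurd h2 h1
        · exact h2
    obtain ⟨m, hm⟩ := exists_pow_lt_of_lt_one (hP0 (k + 1)) hq1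
    refine hcon (n₀ + m) (hconst m) ?_
    rw [hκ, hconst m, if_pos]
    exact (pow_le_pow_of_le_one hq0.le hq1.le (Nat.le_add_left m n₀)).trans hm.le
  refine ⟨κ, fun n => ?_, fun k => ?_, fun n => ?_⟩
  · rw [hκ]; split_ifs <;> simp
  · induction k with
    | zero => exact hex 0 ⟨0, rfl⟩
    | succ k ih =>
      obtain ⟨n, -, hn⟩ := ih
      exact hex (k + 1) ⟨n + 1, hn⟩
  · change q ^ n ≤ P (κ (n + 1))
    induction n with
    | zero =>
      rw [hκ]
      split_ifs with h
      · exact h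
      · simp [hP, κ]
    | succ n ih =>
      rw [hκ]
      split_ifs with h
      · exact h
      · exact (pow_le_pow_of_le_one hq0.le hq1.le n.le_succ).trans ih

lemma exists_separated_finset {X : Type*} [PseudoMetricSpace X] {K : Set X} (hK : IsCompact K)
    {r : ℝ} (hr : 0 < r) : ∃ S : Finset X, (S : Set X) ⊆ K ∧
      (∀ x ∈ S, ∀ y ∈ S, x ≠ y → r ≤ dist x y) ∧ (coverNum r.toNNReal K : ℝ≥0∞) ≤ S.card := by
  have htop : Metric.packingNumber r.toNNReal K ≠ ⊤ := by
    have h1 := Metric.packingNumber_two_mul_le_externalCoveringNumber (r / 2).toNNReal K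
    have h2 : 2 * (r / 2).toNNReal = r.toNNReal := by
      rw [← Real.toNNReal_ofNat, ← Real.toNNReal_mul two_pos.le, mul_div_cancel₀ _ two_ne_zero]
    have h3 : coverNum (r / 2).toNNReal K ≠ ⊤ := by
      simpa using coverNum_ne_top hK (half_pos hr)
    rw [h2] at h1
    exact ne_top_of_le_ne_top h3 h1
  obtain ⟨S, hSK, hfin, hsep, hcard⟩ := Metric.exists_set_encard_eq_packingNumber htop
  refine ⟨hfin.toFinset, by simpa using hSK, fun x hx y hy hxy => ?_, ?_⟩
  · have h1 : ENNReal.ofReal r < edist x y :=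
      hsep (hfin.mem_toFinset.1 hx) (hfin.mem_toFinset.1 hy) hxy
    rw [edist_dist] at h1
    exact (ENNReal.ofReal_lt_ofReal_iff'.1 h1).1.le
  · have h1 : coverNum r.toNNReal K ≤ (hfin.toFinset.card : ℕ∞) := by
      rw [← hfin.encard_eq_coe_toFinset_card, hcard]
      exact (Metric.externalCoveringNumber_le_coveringNumber _ _).trans
        (Metric.coveringNumber_le_packingNumber _ _)
    simpa using ENat.toENNReal_le.2 h1

/-! ### Uniformly self-embeddable sets -/

section Uniform

variable {X : Type*} [MetricSpace X] {K : Set X} {a : ℝ}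

/-- With uniform constants the same proportion `η` of the radius works for all balls: one ball of
large content is fixed, and copied everywhere. -/
lemma exists_hasContent_near (hK : IsCompact K) (hne : K.Nonempty) (ha0 : 0 < a) (ha1 : a ≤ 1)
    (hemb : ∀ z ∈ K, ∀ r : ℝ, 0 < r → r ≤ 1 → HasEmbedding K z r a) {α : ℝ≥0}
    (hα : assouadDim K = α) {ε : ℝ} (hε : 0 < ε) :
    ∃ η, 0 < η ∧ η ≤ ε ∧ ∀ z ∈ K, ∀ r : ℝ, 0 < r → r ≤ 1 → ∃ z' ∈ K, dist z' z ≤ r ∧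
      HasContent (Metric.closedBall z' (η * r) ∩ K) (η * r) ε
        (4 ^ (-α : ℝ) * (a ^ 2 / 2) ^ (α : ℝ)) α := by
  have : Nonempty X := ⟨hne.some⟩
  obtain ⟨y, ⟨y, hy, rfl⟩, R, hR, hRε, hcont⟩ := exists_hasContent_image hK hne hα (f := id)
    one_pos (L := 1) (fun x _ y _ => by simp) hε (mul_pos ha0 hε)
  rw [Set.image_id, id] at hcont
  refine ⟨a⁻¹ * R, by positivity, ?_, fun z hz r hr hr1 => ?_⟩
  · rw [inv_mul_le_iff₀ ha0]; exact hRε.le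
  obtain ⟨f, hf, hd⟩ := hemb z hz r hr hr1
  refine ⟨f y, (hf hy).2, (hf hy).1, ?_⟩
  have h1 := hcont.image Set.inter_subset_right hε hR ha0 ha1 hr fun x hx y hy => (hd x hx y hy).1
  rw [mul_right_comm] at h1
  refine h1.mono_set ?_
  rintro _ ⟨x, ⟨hxy, hx⟩, rfl⟩
  refine ⟨?_, (hf hx).2⟩
  rw [Metric.mem_closedBall] at *
  calc dist (f x) (f y) ≤ a⁻¹ * r * dist x y := (hd x hx y hy).2
    _ ≤ a⁻¹ * r * R := by gcongr
    _ = a⁻¹ * R * r := by ring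

/-- Inside every ball the copies of a large separated set span a tree whose branching exceeds the
exponent `s`. At a sparse set of levels a branch first moves to a ball of large content. Since the
contraction `η k` required for this is the same for all vertices, these levels can be chosen so
sparse that they do not affect the dimension of the limit set. -/
lemma le_dimH_richPoints (hK : IsCompact K) (hne : K.Nonempty) (ha0 : 0 < a) (ha1 : a ≤ 1)
    (hemb : ∀ z ∈ K, ∀ r : ℝ, 0 < r → r ≤ 1 → HasEmbedding K z r a) {α : ℝ≥0}
    (hα : assouadDim K = α) {s : ℝ≥0} (hs0 : 0 < s) (hs : s < upperBoxDim K) :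
    s ≤ dimH (richPoints K (4 ^ (-α : ℝ) * (a ^ 2 / 2) ^ (α : ℝ) * 2 ^ (-α : ℝ)) α) := by
  obtain ⟨s', hss, hs'⟩ := ENNReal.lt_iff_exists_nnreal_btwn.1 hs
  have hss' : (0 : ℝ) < s' - s := sub_pos.2 (by exact_mod_cast hss)
  -- the scale `σ` of the separated set is so small that `N * t ^ s > 1`
  have hev : ∀ᶠ r : ℝ in 𝓝[>] 0, r < 1 ∧ r ^ (s' - s : ℝ) < (a / 32) ^ (s : ℝ) := by
    have h1 : Tendsto (fun r : ℝ => r ^ (s' - s : ℝ)) (𝓝[>] 0) (𝓝 (0 ^ (s' - s : ℝ))) :=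
      ((Real.continuous_rpow_const hss'.le).tendsto 0).mono_left nhdsWithin_le_nhds
    rw [Real.zero_rpow hss'.ne'] at h1
    have h2 : ∀ᶠ r : ℝ in 𝓝[>] 0, r ∈ Set.Ioo 0 1 := Ioo_mem_nhdsGT one_pos
    filter_upwards [h2, h1.eventually (gt_mem_nhds
      (show (0 : ℝ) < (a / 32) ^ (s : ℝ) by positivity))] with r h3 h4
    exact ⟨h3.2, h4⟩
  obtain ⟨σ, hσ0, ⟨hσ1, hσa⟩, hσN⟩ := exists_lt_coverNum_of_lt_upperBoxDim hs' hev
  obtain ⟨S, hSK, hSsep, hScard⟩ := exists_separated_finset hK hσ0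
  set N := S.card with hN
  have hNσ : σ ^ (-(s' : ℝ)) < N := by
    have h1 := hσN.trans_le hScard
    rw [← ENNReal.ofReal_natCast] at h1
    exact (ENNReal.ofReal_lt_ofReal_iff'.1 h1).1
  have hN1 : 1 < N := by
    have h1 : 1 ≤ σ ^ (-(s' : ℝ)) :=
      Real.one_le_rpow_of_pos_of_le_one_of_nonpos hσ0 hσ1.le (by simp)
    exact_mod_cast h1.trans_lt hNσ
  set t := a * σ / 32 with ht
  have ht0 : 0 < t := by positivity
  have ht1 : t ≤ 1 / 32 := by
    have : a * σ ≤ 1 := mul_le_one₀ ha1 hσ0.le hσ1.le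
    linarith
  have hNt : 1 < N * t ^ (s : ℝ) := by
    have h1 : t ^ (s : ℝ) = (a / 32) ^ (s : ℝ) * σ ^ (s : ℝ) := by
      rw [← Real.mul_rpow (by positivity) hσ0.le]
      congr 1; ring
    calc (1 : ℝ) = σ ^ (-(s' : ℝ)) * (σ ^ (s' - s : ℝ) * σ ^ (s : ℝ)) := by
          rw [← Real.rpow_add hσ0, ← Real.rpow_add hσ0]
          simp
      _ < N * t ^ (s : ℝ) := by
          rw [h1]
          gcongr
  set q := (N * t ^ (s : ℝ))⁻¹ with hq
  have hq0 : 0 < q := by positivity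
  have hq1 : q < 1 := inv_lt_one_of_one_lt₀ hNt
  have hk0 : ∀ k : ℕ, (0 : ℝ) < 1 / ((k : ℝ) + 1) := fun k => Nat.one_div_pos_of_nat
  choose η hη0 hηk hη using fun k : ℕ => exists_hasContent_near hK hne ha0 ha1 hemb hα (hk0 k)
  have hη1 : ∀ k, η k ≤ 1 := fun k => (hηk k).trans
    ((div_le_one (by positivity)).2 (by linarith [Nat.cast_nonneg (α := ℝ) k]))
  obtain ⟨κ, hκ, hκk, hκq⟩ := exists_slow_counter hη0 (s := s) hq0 hq1
  set P : ℕ → ℝ := fun k => ∏ i ∈ Finset.range k, η i with hP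
  have hP0 : ∀ k, 0 < P k := fun k => Finset.prod_pos fun i _ => hη0 i
  have hP1 : ∀ k, P k ≤ 1 := fun k => Finset.prod_le_one (fun i _ => (hη0 i).le) fun i _ => hη1 i
  set ρ : ℕ → ℝ := fun n => t ^ n * P (κ n) with hρ
  have hρ0 : ∀ n, 0 < ρ n := fun n => mul_pos (by positivity) (hP0 _)
  have hρ1 : ∀ n, ρ n ≤ 1 := fun n =>
    mul_le_one₀ (pow_le_one₀ ht0.le (by linarith)) (hP0 _).le (hP1 _)
  have hρfree : ∀ n, κ (n + 1) = κ n → ρ (n + 1) = t * ρ n := fun n h => by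
    simp only [hρ, h]; ring
  have hρspec : ∀ n, κ (n + 1) = κ n + 1 → ρ (n + 1) = t * (η (κ n) * ρ n) := fun n h => by
    simp only [hρ, h, hP, Finset.prod_range_succ]; ring
  have hρhalf : ∀ n, ρ (n + 1) ≤ ρ n / 2 := fun n => by
    have h0 := hρ0 n
    rcases hκ n with h | h
    · rw [hρfree n h]; nlinarith
    · rw [hρspec n h]
      have h1 : η (κ n) * ρ n ≤ ρ n := mul_le_of_le_one_left h0.le (hη1 _)
      have h2 : 0 < η (κ n) * ρ n := mul_pos (hη0 _) h0
      nlinarith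
  have hfree : ∀ z ∈ K, ∀ r : ℝ, 0 < r → r ≤ 1 → ∃ g : Fin N → K, (∀ i, dist (g i : X) z ≤ r) ∧
      ∀ i j, i ≠ j → a * r * σ ≤ dist (g i : X) (g j) := by
    intro z hz r hr hr1
    obtain ⟨f, hf, hd⟩ := hemb z hz r hr hr1
    have hw : ∀ i : Fin N, ((S.equivFin.symm i : S) : X) ∈ K := fun i => hSK (S.equivFin.symm i).2
    refine ⟨fun i => ⟨f (S.equivFin.symm i), (hf (hw i)).2⟩, fun i => (hf (hw i)).1,
      fun i j hij => ?_⟩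
    refine le_trans ?_ (hd _ (hw i) _ (hw j)).1
    gcongr
    refine hSsep _ (S.equivFin.symm i).2 _ (S.equivFin.symm j).2 fun h => hij ?_
    exact S.equivFin.symm.injective (Subtype.ext h)
  have hstep : ∀ (n : ℕ) (z : K), ∃ g : Fin N → K, (∀ i, dist (g i : X) z ≤ ρ n / 2) ∧
      (∀ i j, i ≠ j → 4 * ρ (n + 1) ≤ dist (g i : X) (g j)) ∧
      (κ (n + 1) = κ n + 1 → ∃ z', (∀ i, dist (g i : X) z' ≤ η (κ n) * (ρ n / 4) / 2) ∧
        HasContent (Metric.closedBall z' (η (κ n) * (ρ n / 4)) ∩ K) (η (κ n) * (ρ n / 4))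
          (1 / ((κ n : ℝ) + 1)) (4 ^ (-α : ℝ) * (a ^ 2 / 2) ^ (α : ℝ)) α) := by
    rintro n ⟨z, hz⟩
    have h0 := hρ0 n
    have h1 := hρ1 n
    rcases hκ n with h | h
    · obtain ⟨g, hg1, hg2⟩ := hfree z hz (ρ n / 2) (by positivity) (by linarith)
      refine ⟨g, hg1, fun i j hij => le_trans ?_ (hg2 i j hij), fun h' => by omega⟩
      rw [hρfree n h, ht]
      have : 0 < a * σ * ρ n := by positivity
      linarith
    · have hη0' := hη0 (κ n)
      have hη1' := hη1 (κ n)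
      have hR : 0 < η (κ n) * (ρ n / 4) / 2 := by positivity
      have hR1 : η (κ n) * (ρ n / 4) / 2 ≤ ρ n / 4 := by nlinarith
      obtain ⟨z', hz', hzz, hcont⟩ := hη (κ n) z hz (ρ n / 4) (by positivity) (by linarith)
      obtain ⟨g, hg1, hg2⟩ := hfree z' hz' (η (κ n) * (ρ n / 4) / 2) hR (by linarith)
      refine ⟨g, fun i => ?_, fun i j hij => le_trans ?_ (hg2 i j hij),
        fun _ => ⟨z', hg1, hcont⟩⟩
      · linarith [dist_triangle (g i : X) z' z, hg1 i]
      · rw [hρspec n h, ht]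
        exact le_of_eq (by ring)
  choose g hg1 hg2 hg3 using hstep
  let Z : (ℕ → Fin N) → ℕ → K := fun u n =>
    Nat.rec ⟨hne.some, hne.some_mem⟩ (fun n z => g n z (u n)) n
  have hZ : ∀ u n, Z u (n + 1) = g n (Z u n) (u n) := fun u n => rfl
  have hlim : ∀ u : ℕ → Fin N, ∃ x : X, x ∈ K ∧ ∀ n : ℕ, dist ((Z u n).1) x ≤ ρ n := fun u =>
    exists_limit_of_nested hK (z := fun n => ((Z u n).1)) (fun n => (Z u n).2) hρ0 hρhalf
      fun n => hg1 n (Z u n) (u n)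
  choose π hπK hπ using hlim
  have hrich : Set.range π ⊆
      richPoints K (4 ^ (-α : ℝ) * (a ^ 2 / 2) ^ (α : ℝ) * 2 ^ (-α : ℝ)) α := by
    rintro _ ⟨u, rfl⟩
    refine mem_richPoints_of_near (hπK u) fun k => ?_
    obtain ⟨n, rfl, hn⟩ := hκk k
    obtain ⟨z', hz', hcont⟩ := hg3 n (Z u n) hn
    have h0 := hρ0 n
    have hη0' := hη0 (κ n)
    have hpos : 0 < η (κ n) * ρ n := mul_pos hη0' h0
    refine ⟨z', _, by positivity, ?_, ?_, hcont⟩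
    · have : η (κ n) * (ρ n / 4) ≤ η (κ n) := by nlinarith [hρ1 n]
      exact this.trans (hηk _)
    · have h1 := hπ u (n + 1)
      rw [hρspec n hn, hZ] at h1
      have h2 := hz' (u n)
      have h3 := dist_triangle_left z' (π u) (g n (Z u n) (u n) : X)
      nlinarith
  refine (le_dimH_range_of_separated hN1 hs0 (C := ((t ^ (s : ℝ))⁻¹).toNNReal)
    (δ := fun n => 2 * ρ (n + 1)) (fun n => mul_pos two_pos (hρ0 _)) π ?_ ?_).trans
    (dimH_mono hrich)
  · intro u v n huv hne
    have hZuv : ∀ m ≤ n, Z u m = Z v m := by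
      intro m hm
      induction m with
      | zero => rfl
      | succ m ih => rw [hZ, hZ, ih (by omega), huv m (by omega)]
    have h1 := hg2 n (Z u n) (u n) (v n) hne
    have h2 := hπ u (n + 1)
    have h3 := hπ v (n + 1)
    rw [hZ] at h2 h3
    rw [← hZuv n le_rfl] at h3
    have h4 := dist_triangle4 (g n (Z u n) (u n) : X) (π u) (π v) (g n (Z u n) (v n) : X)
    rw [dist_comm (π v)] at h4
    linarith
  · intro n
    have h0 := hρ0 (n + 1)
    have hts : 0 < t ^ (s : ℝ) := by positivity
    have hN0 : (0 : ℝ) < N := by exact_mod_cast zero_lt_one.trans hN1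
    rw [Real.coe_toNNReal _ (by positivity)]
    calc ((N : ℝ) ^ n)⁻¹ = q ^ n * (t ^ (s : ℝ)) ^ n := by
          rw [hq, ← mul_pow, mul_inv, mul_assoc, inv_mul_cancel₀ hts.ne', mul_one, inv_pow]
      _ ≤ P (κ (n + 1)) ^ (s : ℝ) * (t ^ (s : ℝ)) ^ n := by
          gcongr
          exact hκq n
      _ = (t ^ (s : ℝ))⁻¹ * ρ (n + 1) ^ (s : ℝ) := by
          simp only [hρ]
          rw [Real.mul_rpow (by positivity) (hP0 _).le, ← Real.rpow_pow_comm ht0.le, pow_succ]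
          field_simp
      _ ≤ (t ^ (s : ℝ))⁻¹ * (2 * ρ (n + 1)) ^ (s : ℝ) := by
          gcongr
          linarith

end Uniform

end SelfEmbed

theorem theoremA (d : ℕ) (K : Set (EuclideanSpace ℝ (Fin d))) (hne : K.Nonempty)
    (hK : IsCompact K) (hemb : SelfEmbed.IsSelfEmbeddable K) :
    (∀ x ∈ K, SelfEmbed.upperBoxDim K ≤ SelfEmbed.pointwiseAssouadDim K x) ∧
    (∃ x ∈ K, ∃ F ∈ SelfEmbed.tangents K x,
      0 < μH[(SelfEmbed.assouadDim K).toReal] F ∧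
      dimH F = SelfEmbed.pointwiseAssouadDim K x ∧
      SelfEmbed.pointwiseAssouadDim K x = SelfEmbed.assouadDim K) ∧
    (SelfEmbed.IsUniformlySelfEmbeddable K →
      (∃ c : ℝ≥0, 0 < c ∧
        {x ∈ K | ∃ F ∈ SelfEmbed.tangents K x,
          (c : ℝ≥0∞) ≤ μH[(SelfEmbed.assouadDim K).toReal] F}.Nonempty ∧
        dimH {x ∈ K | ∃ F ∈ SelfEmbed.tangents K x,
          (c : ℝ≥0∞) ≤ μH[(SelfEmbed.assouadDim K).toReal] F} = dimH K) ∧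
      dimH K = SelfEmbed.upperBoxDim K) := by
  obtain ⟨α, hα⟩ : ∃ α : ℝ≥0, SelfEmbed.assouadDim K = α :=
    ⟨_, (ENNReal.coe_toNNReal (SelfEmbed.assouadDim_ne_top hK)).symm⟩
  have hαr : (SelfEmbed.assouadDim K).toReal = α := by rw [hα, ENNReal.coe_toReal]
  rw [hαr]
  set c₀ : ℝ := 4 ^ (-α : ℝ) * 2 ^ (-α : ℝ) with hc₀
  have hc₀0 : 0 < c₀ := by positivity
  have hc₀1 : c₀ ≤ 1 := mul_le_one₀
    (Real.rpow_le_one_of_one_le_of_nonpos (by norm_num) (by simp)) (by positivity)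
    (Real.rpow_le_one_of_one_le_of_nonpos (by norm_num) (by simp))
  have htan : ∀ c ≤ (1 : ℝ), ∀ x ∈ SelfEmbed.richPoints K c α,
      ∃ F ∈ SelfEmbed.tangents K x, ENNReal.ofReal c ≤ μH[α] F := fun c hc x hx =>
    SelfEmbed.exists_tangent_of_hasContent hK hx.1 α.coe_nonneg hc hx.2
  obtain ⟨x₀, hx₀⟩ := hemb.richPoints_nonempty hK hne hα
  refine ⟨fun x hx => hemb.upperBoxDim_le hK.isBounded hx, ?_, fun huni => ?_⟩
  · obtain ⟨F, hF, hμ⟩ := htan c₀ hc₀1 x₀ hx₀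
    have hpos : 0 < μH[α] F := (ENNReal.ofReal_pos.2 hc₀0).trans_le hμ
    -- `α ≤ dimH F ≤ dim_A (K, x₀) ≤ dim_A K = α`
    have h1 : (α : ℝ≥0∞) ≤ dimH F := le_dimH_of_hausdorffMeasure_ne_zero hpos.ne'
    have h2 := SelfEmbed.dimH_le_pointwiseAssouadDim hF
    have h3 := SelfEmbed.pointwiseAssouadDim_le_assouadDim hx₀.1
    refine ⟨x₀, hx₀.1, F, hF, hpos, le_antisymm h2 ?_, le_antisymm h3 ?_⟩
    · exact (h3.trans_eq hα).trans h1
    · exact hα.trans_le (h1.trans h2)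
  · obtain ⟨a, ha0, ha1, ha⟩ := huni.exists_hasEmbedding hK.isBounded
    set c : ℝ := 4 ^ (-α : ℝ) * (a ^ 2 / 2) ^ (α : ℝ) * 2 ^ (-α : ℝ) with hc
    have hc0 : 0 < c := by positivity
    have hcc : c ≤ c₀ := by
      have h1 : (a ^ 2 / 2) ^ (α : ℝ) ≤ 1 :=
        Real.rpow_le_one (by positivity) (by nlinarith) α.coe_nonneg
      rw [hc, hc₀]
      gcongr
      exact mul_le_of_le_one_right (by positivity) h1
    have hsub : SelfEmbed.richPoints K c α ⊆
        {x ∈ K | ∃ F ∈ SelfEmbed.tangents K x, ((c.toNNReal : ℝ≥0) : ℝ≥0∞) ≤ μH[α] F} :=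
      fun x hx => ⟨hx.1, htan c (hcc.trans hc₀1) x hx⟩
    have hlow : SelfEmbed.upperBoxDim K ≤ dimH (SelfEmbed.richPoints K c α) := by
      refine le_of_forall_lt fun s hs => ?_
      obtain ⟨s₁, h1, h2⟩ := ENNReal.lt_iff_exists_nnreal_btwn.1 hs
      have h3 : 0 < s₁ := by
        have : (0 : ℝ≥0∞) < s₁ := (zero_le).trans_lt h1
        exact_mod_cast this
      exact h1.trans_le (SelfEmbed.le_dimH_richPoints hK hne ha0 ha1 ha hα h3 h2)
    have hsK : dimH {x ∈ K | ∃ F ∈ SelfEmbed.tangents K x,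
        ((c.toNNReal : ℝ≥0) : ℝ≥0∞) ≤ μH[α] F} ≤ dimH K := dimH_mono fun x hx => hx.1
    have hlow' := hlow.trans (dimH_mono hsub)
    have hup := SelfEmbed.dimH_le_upperBoxDim K
    refine ⟨⟨c.toNNReal, by simpa using hc0, ⟨x₀, hsub (SelfEmbed.richPoints_mono hcc hx₀)⟩,
      le_antisymm hsK (hup.trans hlow')⟩, le_antisymm hup (hlow'.trans hsK)⟩
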